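/- \textbf{Lemma (One-step transition probability approximation).} Consider a finite game with a finite set $\mathcal I$ of $n$ agents, finite action sets $\mathcal A_i$, profiles $\mathcal A=\prod_i\mathcal A_i$ and utilities $u_i:\mathcal A\to(0,\infty)$. Fix constants $\epsilon,\nu,h,c>0$ with $\epsilon\nu<1$ and $\epsilon h<1$. A state is $z=(\alpha,x,\rho,\upsilon)$: an action profile $\alpha$, strategies $x_i\in\Delta(\mathcal A_i)$, aspiration levels $\rho\in\mathbb R^n$ and noise $\upsilon\in\mathbb R^n$. In one step of the \emph{unperturbed process} (transition function $P$), every agent $i$ independently draws a new action $\alpha_i^+$ from $x_i$; a noise vector $\upsilon^+$ is drawn from a conditional law $N(\cdot\mid z,\alpha^+)$ (for instance i.i.d. noise); and, with $\tilde u_i=u_i(\alpha^+)+\upsilon_i^+$, $$x_i^+=x_i+\epsilon\,(e_{\alpha_i^+}-x_i)\,\phi(\tilde u_i,\tilde u_i-\rho_i),\qquad \rho_i^+=\rho_i+\epsilon\nu\,(\tilde u_i-\rho_i),$$ where $\phi(x,y)=x$ if $y\ge 0$ and $\phi(x,y)=\max\{h,x+cy\}$ if $y<0$. Let $Q$ be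 the transition function of the same step, except that one agent, chosen uniformly among the $n$ agents, trembles, i.e. draws its action uniformly. Let $\mathbb P_\mu$ be the law of the unperturbed process with initial law $\mu$. A \emph{pure strategy state} is a state with $x_i=e_{\alpha_i}$ and $\rho_i=u_i(\alpha)$ for all $i$. Fix $p\in[1,\infty]$, let $|\cdot|$ be the $\ell^p$ norm ($p=2$: Euclidean norm, $p=\infty$: maximum norm), and for a pure strategy state $s'=(\alpha',x',\rho',\cdot)$ let $$\mathcal N_\delta(s')=\{(\alpha,x,\rho,\upsilon):\alpha=\alpha',\ |x-x'|<\delta,\ |\rho-\rho'|<\delta\}.$$ Let the noise law $N=N_\delta$ and the noise level $\overline\upsilon=\overline\upsilon(\delta)$ depend on $\delta>0$ in such a way that, for all sufficiently small $\delta>0$: $|(\overline\upsilon(\delta),\dots,\overline\upsilon(\delta))|<\delta$ (that is, $n^{1/p}\,\overline\upsilon(\delta)<\delta$; for $p=\infty$, $\overline\upsilon(\delta)<\delta$), and, for all states and all played profiles $\alpha^+$, almost surely $\upsilon^+_i\in[-\overline\upsilon(\delta),\overline\upsilon(\delta)]$ and $0<\epsilon\tilde u_i<1$ for all $i$. Let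 $s,s'$ be pure strategy states whose action profiles $\alpha,\alpha'$ differ exactly in the action of a single agent $j$, and put $\gamma_j=1/(n|\mathcal A_j|)$. Let $z'$ be the (noise-dependent) state reached from $s$ in one step in which the profile $\alpha'$ is played, and define $$\hat P_{ss'}(\delta)=\lim_{t\to\infty}QP^t(s,\mathcal N_\delta(s')),\qquad \breve P_{ss'}(\delta)=\mathbb P_{\mathrm{law}(z')}\big[\tau(\mathcal N_\delta(s'))<\infty\big],$$ where $\tau(S)=\inf\{t\ge 0: Z_t\in S\}$. Then: (i) for every $\delta$, $\gamma_j$ is the probability that the profile played in the first step from $s$ under $Q$ is $\alpha'$; (ii) for all sufficiently small $\delta>0$ the limit defining $\hat P_{ss'}(\delta)$ exists; (iii) as $\delta\downarrow 0$, $\hat P_{ss'}(\delta)$ is asymptotically equal to $\gamma_j\,\breve P_{ss'}(\delta)$, i.e. $\hat P_{ss'}(\delta)-\gamma_j\breve P_{ss'}(\delta)=o\big(\gamma_j\breve P_{ss'}(\delta)\big)$; in particular their difference tends to $0$. -/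

import Mathlib

open MeasureTheory ProbabilityTheory Filter
open scoped ENNReal Topology

namespace APLA

/-- Action profiles: one action `a i` in the finite set `A i` for every agent `i`. -/
abbrev Profile {ι : Type*} (A : ι → Type*) : Type _ := ∀ i, A i

/-- States `z = (α, x, ρ, υ)`: action profile, strategy profile, aspiration levels, measurement
noise. The strategies are stored as real vectors; the processes below are started at states
whose strategies are probability vectors, and the strategies remain probability vectors. -/
abbrev State {ι : Type*} (A : ι → Type*) : Type _ :=
  (∀ i, A i) × (∀ i, A i → ℝ) × (ι → ℝ) × (ι → ℝ)

/-- A strategic-form game (utilities `u i`) together with the design parameters of the learning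
dynamics: step size `ε`, relative step size `ν` of the aspiration update, and the constants
`h`, `c` of the aspiration factor. -/
structure Model {ι : Type*} (A : ι → Type*) where
  u : ι → Profile A → ℝ
  ε : ℝ
  ν : ℝ
  h : ℝ
  c : ℝ

section Definitions

variable {ι : Type*} {A : ι → Type*}

abbrev State.action (z : State A) : Profile A := z.1
abbrev State.strategy (z : State A) : ∀ i, A i → ℝ := z.2.1
abbrev State.aspiration (z : State A) : ι → ℝ := z.2.2.1
abbrev State.noise (z : State A) : ι → ℝ := z.2.2.2

/-- The aspiration factor `φ(x, y)`. -/
noncomputable def Model.aspirationFactor (G : Model A) (x y : ℝ) : ℝ :=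
  if 0 ≤ y then x else max G.h (x + G.c * y)

/-- The noisy utility measurement of agent `i` when profile `a` is played with noise `υ`. -/
def Model.measuredUtility (G : Model A) (a : Profile A) (υ : ι → ℝ) (i : ι) : ℝ := G.u i a + υ i

/-- The next state, from state `z`, when profile `a` is played and the noise is `υ`. -/
noncomputable def Model.next [∀ i, DecidableEq (A i)] (G : Model A)
    (z : State A) (a : Profile A) (υ : ι → ℝ) : State A :=
  (a,
   fun i b => z.strategy i b + G.ε * ((Pi.single (a i) (1 : ℝ) : A i → ℝ) b - z.strategy i b) *
     G.aspirationFactor (G.measuredUtility a υ i) (G.measuredUtility a υ i - z.aspiration i),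
   fun i => z.aspiration i + G.ε * G.ν * (G.measuredUtility a υ i - z.aspiration i),
   υ)

/-- A pure strategy state: every agent puts probability one on its current action and its
aspiration level is its nominal utility; the noise coordinate is arbitrary. -/
def Model.IsPureStrategyState [∀ i, DecidableEq (A i)] (G : Model A) (s : State A) : Prop :=
  ∀ i, s.strategy i = Pi.single (s.action i) 1 ∧ s.aspiration i = G.u i s.action

/-- The `δ`-neighbourhood of a state, distances of strategy profiles and of aspiration profiles
being measured in the `ℓ^p` norm (`p = 2` is the Euclidean norm, `p = ∞` the maximum norm);
the noise coordinate is unrestricted. -/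
def nbhd [Fintype ι] [∀ i, Fintype (A i)] (p : ℝ≥0∞) (δ : ℝ) (s : State A) : Set (State A) :=
  {z | z.action = s.action ∧
    ‖WithLp.toLp p (fun k : (i : ι) × A i => z.strategy k.1 k.2 - s.strategy k.1 k.2)‖ < δ ∧
    ‖WithLp.toLp p (fun i : ι => z.aspiration i - s.aspiration i)‖ < δ}

open Classical in
/-- The probability that an agent which does not tremble selects `b` under strategy `x`.
(For an `x` that is not a probability vector, which never occurs along the processes considered,
the value is that of the uniform distribution.) -/
noncomputable def selectProb {B : Type*} [Fintype B] (x : B → ℝ) (b : B) : ℝ≥0∞ :=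
  if x ∈ stdSimplex ℝ B then ENNReal.ofReal (x b) else (Fintype.card B : ℝ≥0∞)⁻¹

open Classical in
/-- The probability that profile `a` is selected when exactly the agents in `T` tremble, i.e.
select uniformly, and all others follow their strategies, independently across agents. -/
noncomputable def profileProb [Fintype ι] [∀ i, Fintype (A i)] (T : Finset ι) (z : State A)
    (a : Profile A) : ℝ≥0∞ :=
  ∏ i, if i ∈ T then (Fintype.card (A i) : ℝ≥0∞)⁻¹ else selectProb (z.strategy i) (a i)

lemma sum_selectProb {B : Type*} [Fintype B] [Nonempty B] (x : B → ℝ) :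
    ∑ b, selectProb x b = 1 := by
  unfold selectProb
  split_ifs with hx
  · rw [← ENNReal.ofReal_sum_of_nonneg (fun b _ => hx.1 b), hx.2, ENNReal.ofReal_one]
  · simp [ENNReal.mul_inv_cancel]

lemma sum_profileProb [Fintype ι] [DecidableEq ι] [∀ i, Fintype (A i)] (T : Finset ι)
    (z : State A) : ∑ a, profileProb T z a = 1 := by
  unfold profileProb
  have key := Finset.prod_univ_sum (fun i => (Finset.univ : Finset (A i)))
    (fun i b => if i ∈ T then (Fintype.card (A i) : ℝ≥0∞)⁻¹ else selectProb (z.strategy i) b)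
  rw [Fintype.piFinset_univ] at key
  trans (∏ i, ∑ b, if i ∈ T then (Fintype.card (A i) : ℝ≥0∞)⁻¹
      else selectProb (z.strategy i) b)
  · rw [key]; congr!
  · refine Finset.prod_eq_one fun i _ => ?_
    have : Nonempty (A i) := ⟨z.action i⟩
    split_ifs with hi
    · simp [ENNReal.mul_inv_cancel]
    · exact sum_selectProb _

end Definitions

section Dynamics

variable {ι : Type*} [Fintype ι] [DecidableEq ι] {A : ι → Type*} [∀ i, Fintype (A i)]
  [∀ i, DecidableEq (A i)] [∀ i, MeasurableSpace (A i)] [∀ i, MeasurableSingletonClass (A i)]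

lemma measurable_selectProb {B : Type*} [Fintype B] (b : B) :
    Measurable (fun x : B → ℝ => selectProb x b) := by
  unfold selectProb
  exact Measurable.ite (isClosed_stdSimplex ℝ B).measurableSet (by fun_prop) measurable_const

lemma measurable_profileProb (T : Finset ι) (a : Profile A) :
    Measurable (fun z : State A => profileProb T z a) := by
  unfold profileProb
  refine Finset.measurable_prod _ fun i _ => ?_
  split_ifs
  · exact measurable_const
  · exact (measurable_selectProb (a i)).comp
      ((measurable_pi_apply i).comp (measurable_fst.comp measurable_snd))

/-- The law of the next action profile when exactly the agents in `T` tremble. -/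
noncomputable def actionKernel (T : Finset ι) : Kernel (State A) (Profile A) where
  toFun z := ∑ a, profileProb T z a • Measure.dirac a
  measurable' := by
    refine Measure.measurable_of_measurable_coe _ fun S hS => ?_
    simp only [Measure.coe_finsetSum, Finset.sum_apply, Measure.smul_apply, smul_eq_mul]
    exact Finset.measurable_sum _ fun a _ => (measurable_profileProb T a).mul_const _

instance (T : Finset ι) : IsMarkovKernel (actionKernel (A := A) T) := by
  refine ⟨fun z => ⟨?_⟩⟩
  change (∑ a, profileProb T z a • Measure.dirac a) Set.univ = 1
  simp [sum_profileProb]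

lemma Model.measurable_next (G : Model A) :
    Measurable (fun q : State A × Profile A × (ι → ℝ) => G.next q.1 q.2.1 q.2.2) := by
  have hm : ∀ i, Measurable (fun q : State A × Profile A × (ι → ℝ) =>
      G.measuredUtility q.2.1 q.2.2 i) := fun i => by
    unfold Model.measuredUtility
    exact ((measurable_of_countable (G.u i)).comp (by fun_prop)).add (by fun_prop)
  have hr : ∀ i, Measurable (fun q : State A × Profile A × (ι → ℝ) => q.1.aspiration i) :=
    fun i => by unfold State.aspiration; fun_prop
  have hx : ∀ i b, Measurable (fun q : State A × Profile A × (ι → ℝ) => q.1.strategy i b) :=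
    fun i b => by unfold State.strategy; fun_prop
  have he : ∀ i b, Measurable (fun q : State A × Profile A × (ι → ℝ) =>
      (Pi.single (q.2.1 i) (1 : ℝ) : A i → ℝ) b) := fun i b =>
    (measurable_of_countable (fun d : A i => (Pi.single d (1 : ℝ) : A i → ℝ) b)).comp
      (by fun_prop)
  have hφ : ∀ i, Measurable (fun q : State A × Profile A × (ι → ℝ) =>
      G.aspirationFactor (G.measuredUtility q.2.1 q.2.2 i)
        (G.measuredUtility q.2.1 q.2.2 i - q.1.aspiration i)) := fun i => by
    unfold Model.aspirationFactor
    exact Measurable.ite (measurableSet_le measurable_const ((hm i).sub (hr i))) (hm i)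
      (measurable_const.max ((hm i).add (((hm i).sub (hr i)).const_mul _)))
  unfold Model.next
  refine Measurable.prodMk (by fun_prop) (Measurable.prodMk ?_ (Measurable.prodMk ?_ (by fun_prop)))
  · refine measurable_pi_lambda _ fun i => measurable_pi_lambda _ fun b => ?_
    exact (hx i b).add ((((he i b).sub (hx i b)).const_mul _).mul (hφ i))
  · refine measurable_pi_lambda _ fun i => ?_
    exact (hr i).add (((hm i).sub (hr i)).const_mul _)

/-- One step of the dynamics when exactly the agents in `T` tremble: draw the action profile `a`,
then the noise from its conditional law `N (z, a)`, then update strategies and aspirations. -/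
noncomputable def Model.step (G : Model A) (N : Kernel (State A × Profile A) (ι → ℝ))
    (T : Finset ι) : Kernel (State A) (State A) :=
  (Kernel.id ×ₖ (actionKernel T ⊗ₖ N)).map (fun q => G.next q.1 q.2.1 q.2.2)

instance (G : Model A) (N : Kernel (State A × Profile A) (ι → ℝ)) [IsMarkovKernel N]
    (T : Finset ι) : IsMarkovKernel (G.step N T) :=
  Kernel.IsMarkovKernel.map _ G.measurable_next

/-- The transition probability function `P` of the unperturbed process: no agent trembles. -/
noncomputable def Model.unperturbed (G : Model A) (N : Kernel (State A × Profile A) (ι → ℝ)) :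
    Kernel (State A) (State A) := G.step N ∅

instance (G : Model A) (N : Kernel (State A × Profile A) (ι → ℝ)) [IsMarkovKernel N] :
    IsMarkovKernel (G.unperturbed N) :=
  inferInstanceAs (IsMarkovKernel (G.step N ∅))

/-- The transition probability function `Q`: exactly one agent, chosen uniformly among all
agents, trembles. -/
noncomputable def Model.oneTremble (G : Model A) (N : Kernel (State A × Profile A) (ι → ℝ)) :
    Kernel (State A) (State A) where
  toFun z := (Fintype.card ι : ℝ≥0∞)⁻¹ • ∑ i, G.step N {i} z
  measurable' := by
    refine Measure.measurable_of_measurable_coe _ fun S hS => ?_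
    simp only [Measure.smul_apply, Measure.coe_finsetSum, Finset.sum_apply, smul_eq_mul]
    exact (Finset.measurable_sum _ fun i _ => (G.step N {i}).measurable_coe hS).const_mul _

/-- `Q P^t (s, S)`: one step of `Q` followed by `t` steps of `P`. -/
noncomputable def Model.trembleThen (G : Model A) (N : Kernel (State A × Profile A) (ι → ℝ))
    (t : ℕ) (s : State A) (S : Set (State A)) : ℝ :=
  ((((G.unperturbed N) ^ t) ∘ₖ (G.oneTremble N)) s).real S

/-- `P̂_{s s'} = lim_{t → ∞} Q P^t (s, N_δ(s'))`. -/
noncomputable def Model.hatP (G : Model A) (N : Kernel (State A × Profile A) (ι → ℝ))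
    (p : ℝ≥0∞) (δ : ℝ) (s s' : State A) : ℝ :=
  limUnder atTop (fun t : ℕ => G.trembleThen N t s (nbhd p δ s'))

/-- The law, on the path space, of the unperturbed process with initial law `μ`. -/
noncomputable def Model.pathLaw (G : Model A) (N : Kernel (State A × Profile A) (ι → ℝ))
    [IsMarkovKernel N] (μ : Measure (State A)) : Measure (ℕ → State A) :=
  Kernel.trajMeasure (X := fun _ => State A) μ (fun n => (G.unperturbed N).comap
    (fun path : (i : Finset.Iic n) → State A => path ⟨n, Finset.mem_Iic.2 le_rfl⟩)
    (measurable_pi_apply _))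

/-- The law of the state `z'` reached from `s` in one step in which profile `a'` is played
(it is random only through the measurement noise). -/
noncomputable def Model.afterPlaying (G : Model A) (N : Kernel (State A × Profile A) (ι → ℝ))
    (s : State A) (a' : Profile A) : Measure (State A) :=
  (N (s, a')).map (fun υ => G.next s a' υ)

/-- `P̆_{s s'}`: the probability that the unperturbed process, started at the state `z'` reached
from `s` by playing the action profile of `s'` once, hits `N_δ(s')` in finite time. -/
noncomputable def Model.breveP (G : Model A) (N : Kernel (State A × Profile A) (ι → ℝ))
    [IsMarkovKernel N] (p : ℝ≥0∞) (δ : ℝ) (s s' : State A) : ℝ :=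
  (G.pathLaw N (G.afterPlaying N s s'.action)).real
    {ω | hittingAfter (fun (t : ℕ) (ω : ℕ → State A) => ω t) (nbhd p δ s') 0 ω < ⊤}

end Dynamics

end APLA

set_option linter.unusedSectionVars false

/-! Only a tremble of agent `j` to its action in `s'` matters. At `s` all strategies are pure, so if
the profile played in the first step is not that of `s'`, then agent `j` did not play its action in
`s'`. The strategy of `j` gives that action probability zero and keeps doing so, because the update
only adds weight to actions that are played. Hence `Q P^t (s, S) = γ · (law(z') P^t)(S)` exactly,
for every `t` and every measurable `S` whose states carry the profile of `s'`
(`Model.trembleThen_eq`).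

From `z'` on, only agent `j` is random, and it mixes between its two actions in `s` and `s'`. Let
`w` be its weight on the new action. Playing the new action shrinks `1 - w`, and playing the old one
shrinks `w`, in both cases by a factor at most `1 - κ`, with `κ` independent of `δ`. Aspirations and
noise affect the exact factors, but only this bound is used (`IsReinforced`, `Model.isReinforced`).

Such self-reinforcement makes the probability of never leaving a class at least `exp (-r / κ²)`,
where `r` is the probability of leaving it in the next step. Used as a Lyapunov function, this bound
shows that the expected number of class changes is finite. By Borel–Cantelli the played profile is
eventually constant (`IsReinforced.ae_eventually_class`). If it is eventually that of `s'`, the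
strategies converge to those of `s'` and the aspirations contract to within the noise level, so the
path finally stays in the neighbourhood (`eventually_mem_nbhd`). The limit `L` is therefore the
probability of eventually always playing the profile of `s'`.

Clearly `L ≤ P̆`. Conversely, at a hit of the neighbourhood the probability of leaving is at most
`δ`, and the submartingale argument of `IsReinforced.mul_measure_hit_le` gives `exp (-δ / κ²) · P̆ ≤
L`. The factor tends to one as `δ ↓ 0`. -/

namespace APLA

/-! ### Homogeneous Markov chains on path space -/

section MarkovChain

variable {E : Type*} [MeasurableSpace E]

/-- The law on the path space of the time-homogeneous Markov chain with transition kernel `P`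
and initial law `μ`. -/
noncomputable def markovChainLaw (P : Kernel E E) [IsMarkovKernel P] (μ : Measure E) :
    Measure (ℕ → E) :=
  Kernel.trajMeasure (X := fun _ => E) μ (fun n => P.comap
    (fun path : (i : Finset.Iic n) → E => path ⟨n, Finset.mem_Iic.2 le_rfl⟩)
    (measurable_pi_apply _))

variable (P : Kernel E E) [IsMarkovKernel P] (μ : Measure E) [IsProbabilityMeasure μ]

instance : IsProbabilityMeasure (markovChainLaw P μ) := by
  unfold markovChainLaw; infer_instance

/-- The Markov property. -/
lemma lintegral_markovChainLaw_succ (n : ℕ) {F : ((i : Finset.Iic n) → E) × E → ℝ≥0∞}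
    (hF : Measurable F) :
    ∫⁻ ω, F (Preorder.frestrictLe n ω, ω (n + 1)) ∂(markovChainLaw P μ) =
      ∫⁻ ω, ∫⁻ y, F (Preorder.frestrictLe n ω, y) ∂(P (ω n)) ∂(markovChainLaw P μ) := by
  have key := Kernel.map_frestrictLe_trajMeasure_compProd_eq_map_trajMeasure (μ₀ := μ)
    (X := fun _ => E) (κ := fun n => P.comap
    (fun path : (i : Finset.Iic n) → E => path ⟨n, Finset.mem_Iic.2 le_rfl⟩)
    (measurable_pi_apply _)) (a := n)
  have h1 := congrArg (fun m => ∫⁻ q, F q ∂m) key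
  rw [lintegral_map hF (by fun_prop), Measure.lintegral_compProd hF,
    lintegral_map (Measurable.lintegral_kernel_prod_right' hF) (by fun_prop)] at h1
  exact h1.symm

lemma map_markovChainLaw_zero : (markovChainLaw P μ).map (fun ω => ω 0) = μ := by
  have h : (fun ω : ℕ → E => ω 0) =
      (fun x : (i : Finset.Iic 0) → E => x ⟨0, Finset.mem_Iic.2 le_rfl⟩) ∘
        Preorder.frestrictLe (π := fun _ => E) 0 := rfl
  unfold markovChainLaw Kernel.trajMeasure
  rw [h, ← Measure.map_map (by fun_prop) (by fun_prop),
    Measure.map_comp _ _ (by fun_prop), Kernel.traj_map_frestrictLe, Kernel.partialTraj_self,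
    Measure.id_comp, Measure.map_map (by fun_prop) (by fun_prop)]
  exact Measure.map_id

lemma lintegral_markovChainLaw_succ' (n : ℕ) {f : E → ℝ≥0∞} (hf : Measurable f) :
    ∫⁻ ω, f (ω (n + 1)) ∂(markovChainLaw P μ) =
      ∫⁻ ω, ∫⁻ y, f y ∂(P (ω n)) ∂(markovChainLaw P μ) :=
  lintegral_markovChainLaw_succ P μ n (F := fun q => f q.2) (by fun_prop)

/-- This places the marginals `P ^ t` and the hitting events on one path space, where the limit and
the hitting probability can be compared. -/
lemma map_markovChainLaw (t : ℕ) :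
    (markovChainLaw P μ).map (fun ω => ω t) = (P ^ t) ∘ₘ μ := by
  induction t with
  | zero =>
    rw [map_markovChainLaw_zero, pow_zero]
    exact (Measure.id_comp).symm
  | succ t ih =>
    rw [pow_succ']
    change _ = (P ∘ₖ (P ^ t)) ∘ₘ μ
    rw [← Measure.comp_assoc, ← ih]
    ext S hS
    rw [Measure.map_apply (by fun_prop) hS, Measure.bind_apply hS (by fun_prop),
      lintegral_map (P.measurable_coe hS) (by fun_prop)]
    have := lintegral_markovChainLaw_succ' P μ t (f := S.indicator 1) (measurable_one.indicator hS)
    simp only [lintegral_indicator_one hS] at this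
    rw [← this, ← lintegral_indicator_one ((measurable_pi_apply (t+1)) hS)]
    rfl

/-- A transition relation that holds almost surely along one step from every state satisfying an
invariant `K` holds almost surely along the whole path. -/
lemma ae_markovChainLaw {K : E → Prop} {R : E → E → Prop}
    (hR : MeasurableSet {q : E × E | R q.1 q.2}) (h0 : ∀ᵐ z ∂μ, K z)
    (hKR : ∀ z, K z → ∀ᵐ y ∂(P z), R z y) (hKK : ∀ z y, K z → R z y → K y) :
    ∀ᵐ ω ∂(markovChainLaw P μ), ∀ n, K (ω n) ∧ R (ω n) (ω (n + 1)) := by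
  have step : ∀ n, (∀ᵐ ω ∂(markovChainLaw P μ), K (ω n)) →
      ∀ᵐ ω ∂(markovChainLaw P μ), R (ω n) (ω (n + 1)) := by
    intro n hn
    -- The probability of violating `R` at time `n` is the mean of its one-step conditional
    -- probability, which vanishes wherever `K` holds.
    have := lintegral_markovChainLaw_succ P μ n
      (F := fun q => {q : E × E | R q.1 q.2}ᶜ.indicator (1 : E × E → ℝ≥0∞)
        (q.1 ⟨n, Finset.mem_Iic.2 le_rfl⟩, q.2))
      ((measurable_one.indicator hR.compl).comp (by fun_prop))
    have hzero : ∫⁻ ω, ∫⁻ y, {q : E × E | R q.1 q.2}ᶜ.indicator (1 : E × E → ℝ≥0∞)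
        (ω n, y) ∂(P (ω n)) ∂(markovChainLaw P μ) = 0 := by
      rw [lintegral_eq_zero_iff' ]
      · filter_upwards [hn] with ω hω
        refine (lintegral_eq_zero_iff
          ((measurable_one.indicator hR.compl).comp measurable_prodMk_left)).2 ?_
        filter_upwards [hKR _ hω] with y hy
        simp [hy]
      · exact (Measurable.lintegral_kernel_prod_right'
          (measurable_one.indicator hR.compl) |>.comp (measurable_pi_apply n)).aemeasurable
    have hm : Measurable (fun ω : ℕ → E => (ω n, ω (n + 1))) := by fun_prop
    have h2 := (lintegral_eq_zero_iff ((measurable_one.indicator hR.compl).comp hm)).1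
      (this.trans hzero)
    filter_upwards [h2] with ω hω
    by_contra hcon
    simp [hcon] at hω
  have hK : ∀ n, ∀ᵐ ω ∂(markovChainLaw P μ), K (ω n) := by
    intro n
    induction n with
    | zero =>
      rw [← map_markovChainLaw_zero P μ] at h0
      exact (Measure.tendsto_ae_map (measurable_pi_apply 0).aemeasurable) h0
    | succ n ih =>
      filter_upwards [ih, step n ih] with ω h1 h2 using hKK _ _ h1 h2
  rw [ae_all_iff]
  intro n
  filter_upwards [hK n, step n (hK n)] with ω h1 h2 using ⟨h1, h2⟩

end MarkovChain

/-! ### Self-reinforcing two-class chains -/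

section ReinforcedChain

variable {E : Type*} [MeasurableSpace E]

/-- A chain on two classes of states, `B` and its complement: `w z` is the probability of entering
`B` from `z`, and entering a class decreases the probability of leaving it by the factor `1 - κ`.
These properties hold on the states satisfying `K`, which are preserved by the relation `R` that
holds almost surely in each step. -/
structure IsReinforced (P : Kernel E E) (K : E → Prop) (R : E → E → Prop) (B : Set E)
    (w : E → ℝ) (κ : ℝ) : Prop where
  pos : 0 < κ
  lt_one : κ < 1
  measurableSet : MeasurableSet B
  measurable : Measurable w
  measurableSet_rel : MeasurableSet {q : E × E | R q.1 q.2}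
  prob : ∀ z, K z → P z B = ENNReal.ofReal (w z)
  ae_rel : ∀ z, K z → ∀ᵐ y ∂(P z), R z y
  invariant : ∀ z y, K z → R z y → K y
  nonneg : ∀ z, K z → 0 ≤ w z
  le_one : ∀ z, K z → w z ≤ 1
  le_of_mem : ∀ z, K z → z ∈ B → κ ≤ w z
  le_of_notMem : ∀ z, K z → z ∉ B → w z ≤ 1 - κ
  step_mem : ∀ z y, K z → R z y → y ∈ B → 1 - w y ≤ (1 - κ) * (1 - w z)
  step_notMem : ∀ z y, K z → R z y → y ∉ B → w y ≤ (1 - κ) * w z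

/-- A lower bound for the probability of never leaving a class when the probability of leaving it
in the next step is `r`. -/
noncomputable def stayBound (κ r : ℝ) : ℝ := Real.exp (-(r / κ ^ 2))

lemma stayBound_pos (κ r : ℝ) : 0 < stayBound κ r := Real.exp_pos _

lemma stayBound_le_one {κ r : ℝ} (hr : 0 ≤ r) : stayBound κ r ≤ 1 :=
  Real.exp_le_one_iff.2 (by have := div_nonneg hr (sq_nonneg κ); linarith)

lemma stayBound_anti {κ r r' : ℝ} (h : r ≤ r') : stayBound κ r' ≤ stayBound κ r :=
  Real.exp_le_exp.2 (neg_le_neg (div_le_div_of_nonneg_right h (sq_nonneg κ)))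

lemma measurable_stayBound (κ : ℝ) : Measurable (stayBound κ) := by
  unfold stayBound; fun_prop

/-- The exponent splits as `r / κ² = r / κ + (1 - κ) r / κ²`, so the claim is `exp (-r / κ) ≤ 1 -
r`. This follows from `exp (r / κ) ≥ 1 + r / κ` and `(1 + r / κ) (1 - r) ≥ 1`, the latter because `r
≤ 1 - κ`. Iterated, it bounds the product of the factors `1 - (1 - κ)^k r` from below. -/
lemma stayBound_le_mul {κ r : ℝ} (hκ : 0 < κ) (hr : 0 ≤ r) (hr' : r ≤ 1 - κ) :
    stayBound κ r ≤ (1 - r) * stayBound κ ((1 - κ) * r) := by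
  have h1 : stayBound κ r = Real.exp (-(r / κ)) * stayBound κ ((1 - κ) * r) := by
    unfold stayBound
    rw [← Real.exp_add]
    congr 1
    field_simp
    ring
  rw [h1]
  refine mul_le_mul_of_nonneg_right ?_ (stayBound_pos _ _).le
  rw [Real.exp_neg]
  refine inv_le_of_inv_le₀ (by linarith) ?_
  refine le_trans ?_ (Real.add_one_le_exp (r / κ))
  rw [inv_le_iff_one_le_mul₀ (by linarith)]
  have : 0 ≤ (r / κ) * (1 - κ - r) := mul_nonneg (by positivity) (by linarith)
  have h2 : (r / κ + 1) * (1 - r) = 1 + (r / κ) * (1 - κ - r) := by field_simp; ring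
  linarith

namespace IsReinforced

variable {P : Kernel E E} [IsMarkovKernel P] {K : E → Prop} {R : E → E → Prop} {B : Set E}
  {w : E → ℝ} {κ : ℝ} (h : IsReinforced P K R B w κ)
include h

lemma prob_compl {z : E} (hz : K z) : P z Bᶜ = ENNReal.ofReal (1 - w z) := by
  rw [prob_compl_eq_one_sub h.measurableSet, h.prob z hz,
    ENNReal.ofReal_sub _ (h.nonneg z hz), ENNReal.ofReal_one]

lemma le_lintegral {z : E} (hz : K z) {f : E → ℝ≥0∞} {a b : ℝ≥0∞}
    (ha : ∀ y, R z y → y ∈ B → a ≤ f y) (hb : ∀ y, R z y → y ∉ B → b ≤ f y) :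
    ENNReal.ofReal (w z) * a + ENNReal.ofReal (1 - w z) * b ≤ ∫⁻ y, f y ∂(P z) := by
  rw [← lintegral_add_compl f h.measurableSet, ← h.prob z hz, ← h.prob_compl hz,
    mul_comm _ a, mul_comm _ b, ← setLIntegral_const, ← setLIntegral_const]
  refine add_le_add (lintegral_mono_ae ?_) (lintegral_mono_ae ?_)
  · rw [ae_restrict_iff' h.measurableSet]
    filter_upwards [h.ae_rel z hz] with y hy hyB using ha y hy hyB
  · rw [ae_restrict_iff' h.measurableSet.compl]
    filter_upwards [h.ae_rel z hz] with y hy hyB using hb y hy hyB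

open Classical in
lemma measurable_dev : Measurable (fun z => if z ∈ B then 1 - w z else w z) :=
  Measurable.ite h.measurableSet (measurable_const.sub h.measurable) h.measurable

open Classical in
-- Drift inequality. Staying in the class already restores the old value, by `stayBound_le_mul`. A
-- switch contributes at least `stayBound κ 1` on top, so each step gains at least that constant
-- times the switching probability.
lemma stayBound_add_le {z : E} (hz : K z) :
    ENNReal.ofReal (stayBound κ (if z ∈ B then 1 - w z else w z)) +
      ENNReal.ofReal (stayBound κ 1) * ENNReal.ofReal (if z ∈ B then 1 - w z else w z) ≤
    ∫⁻ y, ENNReal.ofReal (stayBound κ (if y ∈ B then 1 - w y else w y)) ∂(P z) := by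
  have h0 := h.nonneg z hz
  have h1 := h.le_one z hz
  have hk := h.lt_one
  have hk' := h.pos
  refine le_trans ?_ (h.le_lintegral hz
    (a := ENNReal.ofReal (stayBound κ ((1 - κ) * (1 - w z))))
    (b := ENNReal.ofReal (stayBound κ ((1 - κ) * w z))) ?_ ?_)
  · rw [← ENNReal.ofReal_mul (stayBound_pos _ _).le, ← ENNReal.ofReal_mul h0,
      ← ENNReal.ofReal_mul (by linarith), ← ENNReal.ofReal_add (stayBound_pos _ _).le,
      ← ENNReal.ofReal_add]
    · refine ENNReal.ofReal_le_ofReal ?_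
      split_ifs with hB
      · have := h.le_of_mem z hz hB
        have e1 := stayBound_le_mul hk' (r := 1 - w z) (by linarith) (by linarith)
        have e2 : stayBound κ 1 ≤ stayBound κ ((1 - κ) * w z) := stayBound_anti (by nlinarith)
        have e3 := mul_le_mul_of_nonneg_left e2 (show 0 ≤ 1 - w z by linarith)
        rw [sub_sub_cancel] at e1
        linarith
      · have := h.le_of_notMem z hz hB
        have e1 := stayBound_le_mul hk' h0 (by linarith)
        have e2 : stayBound κ 1 ≤ stayBound κ ((1 - κ) * (1 - w z)) :=
          stayBound_anti (by nlinarith)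
        have e3 := mul_le_mul_of_nonneg_left e2 h0
        linarith
    · exact mul_nonneg h0 (stayBound_pos _ _).le
    · exact mul_nonneg (by linarith) (stayBound_pos _ _).le
    · exact mul_nonneg (stayBound_pos _ _).le (by split_ifs <;> linarith)
  · intro y hy hyB
    rw [if_pos hyB]
    exact ENNReal.ofReal_le_ofReal (stayBound_anti (h.step_mem z y hz hy hyB))
  · intro y hy hyB
    rw [if_neg hyB]
    exact ENNReal.ofReal_le_ofReal (stayBound_anti (h.step_notMem z y hz hy hyB))

/-- Submartingale property of the staying bound killed outside `B`: inside `B` the event of staying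
suffices, and outside `B` the left side is zero. -/
lemma indicator_stayBound_le {z : E} (hz : K z) :
    B.indicator (fun y => ENNReal.ofReal (stayBound κ (1 - w y))) z ≤
    ∫⁻ y, B.indicator (fun y => ENNReal.ofReal (stayBound κ (1 - w y))) y ∂(P z) := by
  by_cases hB : z ∈ B
  · refine le_trans ?_ (h.le_lintegral hz
      (a := ENNReal.ofReal (stayBound κ ((1 - κ) * (1 - w z)))) (b := 0) ?_ (by simp))
    · rw [Set.indicator_of_mem hB, mul_zero, add_zero, ← ENNReal.ofReal_mul (h.nonneg z hz)]
      refine ENNReal.ofReal_le_ofReal ?_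
      have e1 := stayBound_le_mul h.pos (r := 1 - w z) (by linarith [h.le_one z hz])
        (by linarith [h.le_of_mem z hz hB])
      rwa [sub_sub_cancel] at e1
    · intro y hy hyB
      rw [Set.indicator_of_mem hyB]
      exact ENNReal.ofReal_le_ofReal (stayBound_anti (h.step_mem z y hz hy hyB))
  · simp [hB]

variable {μ : Measure E} [IsProbabilityMeasure μ] (hμ : ∀ᵐ z ∂μ, K z)
include hμ

lemma ae_path : ∀ᵐ ω ∂(markovChainLaw P μ), ∀ n, K (ω n) ∧ R (ω n) (ω (n + 1)) :=
  ae_markovChainLaw P μ h.measurableSet_rel hμ h.ae_rel h.invariant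

open Classical in
lemma measure_switch (n : ℕ) :
    markovChainLaw P μ {ω | ω n ∈ B ↔ ω (n + 1) ∉ B} =
      ∫⁻ ω, ENNReal.ofReal (if ω n ∈ B then 1 - w (ω n) else w (ω n)) ∂(markovChainLaw P μ) := by
  have hB := h.measurableSet
  have hT : MeasurableSet {q : E × E | q.1 ∈ B ↔ q.2 ∉ B} :=
    have hF : MeasurableSet {q : E × E | q.1 ∈ B} := measurable_fst hB
    have hG : MeasurableSet {q : E × E | q.2 ∈ B} := measurable_snd hB
    have : {q : E × E | q.1 ∈ B ↔ q.2 ∉ B} =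
        ({q : E × E | q.1 ∈ B} \ {q : E × E | q.2 ∈ B}) ∪
          ({q : E × E | q.2 ∈ B} \ {q : E × E | q.1 ∈ B}) := by
      ext q; simp only [Set.mem_ofPred_eq, Set.mem_union, Set.mem_sdiff]; tauto
    this ▸ (hF.diff hG).union (hG.diff hF)
  have key := lintegral_markovChainLaw_succ P μ n
    (F := fun q => {q : E × E | q.1 ∈ B ↔ q.2 ∉ B}.indicator (1 : E × E → ℝ≥0∞)
      (q.1 ⟨n, Finset.mem_Iic.2 le_rfl⟩, q.2))
    ((measurable_one.indicator hT).comp (by fun_prop))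
  have hm : Measurable (fun ω : ℕ → E => (ω n, ω (n + 1))) := by fun_prop
  refine (lintegral_indicator_one (hm hT)).symm.trans (key.trans (lintegral_congr_ae ?_))
  filter_upwards [h.ae_path hμ] with ω hω
  refine (lintegral_indicator_one (measurable_prodMk_left (x := ω n) hT)).trans ?_
  split_ifs with hn
  · rw [← h.prob_compl (hω n).1]
    congr 1; ext y; simp [hn]
  · rw [← h.prob _ (hω n).1]
    congr 1; ext y; simp [hn]

open Classical in
-- The drift inequality, integrated and telescoped. The integrand on the right never exceeds one, so
-- the expected number of switches is finite.
lemma sum_switch_le (m : ℕ) :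
    ENNReal.ofReal (stayBound κ 1) *
      ∑ n ∈ Finset.range m, markovChainLaw P μ {ω | ω n ∈ B ↔ ω (n + 1) ∉ B} ≤
    ∫⁻ ω, ENNReal.ofReal (stayBound κ (if ω m ∈ B then 1 - w (ω m) else w (ω m)))
      ∂(markovChainLaw P μ) := by
  have hS : Measurable fun z => ENNReal.ofReal (stayBound κ (if z ∈ B then 1 - w z else w z)) :=
    ((measurable_stayBound κ).comp h.measurable_dev).ennreal_ofReal
  induction m with
  | zero => simp
  | succ m ih =>
    rw [Finset.sum_range_succ, mul_add, lintegral_markovChainLaw_succ' P μ m hS,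
      h.measure_switch hμ, ← lintegral_const_mul]
    · refine (add_le_add_left ih _).trans ?_
      refine (lintegral_add_left (hS.comp (measurable_pi_apply (X := fun _ => E) m))
        _).symm.trans_le (lintegral_mono_ae ?_)
      filter_upwards [h.ae_path hμ] with ω hω using h.stayBound_add_le (hω m).1
    · exact (h.measurable_dev.ennreal_ofReal).comp (measurable_pi_apply m)

/-- Almost surely the chain changes its class only finitely often. -/
lemma ae_eventually_class : ∀ᵐ ω ∂(markovChainLaw P μ),
    (∀ᶠ n in atTop, ω n ∈ B) ∨ (∀ᶠ n in atTop, ω n ∉ B) := by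
  classical
  -- Summability of the switching probabilities is the input of Borel–Cantelli.
  have hsum : ∑' n, markovChainLaw P μ {ω | ω n ∈ B ↔ ω (n + 1) ∉ B} ≠ ∞ := by
    have hq : ENNReal.ofReal (stayBound κ 1) ≠ 0 := by simp [stayBound_pos]
    have hle : ENNReal.ofReal (stayBound κ 1) *
        ∑' n, markovChainLaw P μ {ω | ω n ∈ B ↔ ω (n + 1) ∉ B} ≤ 1 := by
      rw [← ENNReal.tsum_mul_left]
      refine ENNReal.tsum_le_of_sum_range_le fun m => ?_
      rw [← Finset.mul_sum]
      refine (h.sum_switch_le hμ m).trans ?_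
      refine (lintegral_mono_ae (g := fun _ => 1) ?_).trans (by simp)
      filter_upwards [h.ae_path hμ] with ω hω
      refine ENNReal.ofReal_le_one.2 (stayBound_le_one ?_)
      have := h.nonneg _ (hω m).1
      have := h.le_one _ (hω m).1
      split_ifs <;> linarith
    intro htop
    rw [htop, ENNReal.mul_top hq] at hle
    exact absurd hle (by simp)
  filter_upwards [ae_eventually_notMem hsum] with ω hω
  obtain ⟨n0, hn0⟩ := eventually_atTop.1 hω
  have hconst : ∀ n ≥ n0, (ω n ∈ B ↔ ω n0 ∈ B) := by
    intro n hn
    induction n, hn using Nat.le_induction with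
    | base => rfl
    | succ n hn ih => have : ¬(ω n ∈ B ↔ ω (n + 1) ∉ B) := hn0 n hn; tauto
  by_cases hB : ω n0 ∈ B
  · exact Or.inl (eventually_atTop.2 ⟨n0, fun n hn => (hconst n hn).2 hB⟩)
  · exact Or.inr (eventually_atTop.2 ⟨n0, fun n hn => fun hc => hB ((hconst n hn).1 hc)⟩)

/-- Optional stopping, by induction on the horizon `u`. On paths that have already hit `S` the
submartingale does not decrease in mean, and a first hit at the new time contributes at least
`stayBound κ δ`. -/
lemma mul_measure_hit_le {S : Set E} (hS : MeasurableSet S) {δ : ℝ}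
    (hSB : ∀ z, K z → z ∈ S → z ∈ B) (hSδ : ∀ z, K z → z ∈ S → 1 - w z ≤ δ) (u : ℕ) :
    ENNReal.ofReal (stayBound κ δ) * markovChainLaw P μ {ω | ∃ t ≤ u, ω t ∈ S} ≤
      ∫⁻ ω, {ω : ℕ → E | ∃ t ≤ u, ω t ∈ S}.indicator
        (fun ω => B.indicator (fun y => ENNReal.ofReal (stayBound κ (1 - w y))) (ω u)) ω
        ∂(markovChainLaw P μ) := by
  set V : E → ℝ≥0∞ := B.indicator (fun y => ENNReal.ofReal (stayBound κ (1 - w y))) with hVdef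
  have hV : Measurable V := Measurable.indicator
    ((measurable_stayBound κ).comp (measurable_const.sub h.measurable)).ennreal_ofReal
    h.measurableSet
  have hVS : ∀ z, K z → z ∈ S → ENNReal.ofReal (stayBound κ δ) ≤ V z := fun z hz hzS => by
    rw [hVdef, Set.indicator_of_mem (hSB z hz hzS)]
    exact ENNReal.ofReal_le_ofReal (stayBound_anti (hSδ z hz hzS))
  have hmeas : ∀ u : ℕ, MeasurableSet {ω : ℕ → E | ∃ t ≤ u, ω t ∈ S} := fun u => by
    have : {ω : ℕ → E | ∃ t ≤ u, ω t ∈ S} = ⋃ t ∈ Set.Iic u, (fun ω => ω t) ⁻¹' S := by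
      ext; simp
    rw [this]
    exact MeasurableSet.biUnion (Set.to_countable _) fun t _ => measurable_pi_apply t hS
  induction u with
  | zero =>
    rw [← setLIntegral_const, ← lintegral_indicator (hmeas 0)]
    refine lintegral_mono_ae ?_
    filter_upwards [h.ae_path hμ] with ω hω
    by_cases hmem : ω ∈ {ω : ℕ → E | ∃ t ≤ 0, ω t ∈ S}
    · rw [Set.indicator_of_mem hmem, Set.indicator_of_mem hmem]
      obtain ⟨t, ht, htS⟩ := hmem
      obtain rfl : t = 0 := by omega
      exact hVS _ (hω 0).1 htS
    · rw [Set.indicator_of_notMem hmem, Set.indicator_of_notMem hmem]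
  | succ u ih =>
    set H : Set (ℕ → E) := {ω | ∃ t ≤ u, ω t ∈ S} with hH
    have hsub : {ω : ℕ → E | ∃ t ≤ u + 1, ω t ∈ S} = H ∪ ({ω | ω (u + 1) ∈ S} \ H) := by
      ext ω
      simp only [hH, Set.mem_ofPred_eq, Set.mem_union, Set.mem_sdiff]
      constructor
      · rintro ⟨t, ht, htS⟩
        by_cases hc : ∃ t ≤ u, ω t ∈ S
        · exact Or.inl hc
        · rcases Nat.lt_or_ge u t with h1 | h1
          · obtain rfl : t = u + 1 := by omega
            exact Or.inr ⟨htS, hc⟩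
          · exact absurd ⟨t, h1, htS⟩ hc
      · rintro (⟨t, ht, htS⟩ | ⟨h1, -⟩)
        · exact ⟨t, by omega, htS⟩
        · exact ⟨u + 1, le_rfl, h1⟩
    have hmS : MeasurableSet ({ω : ℕ → E | ω (u + 1) ∈ S} \ H) :=
      (measurable_pi_apply (u + 1) hS).diff (hmeas u)
    have hdisj : Disjoint H ({ω | ω (u + 1) ∈ S} \ H) := Set.disjoint_sdiff_right
    have hstep : ∫⁻ ω, H.indicator (fun ω => V (ω u)) ω ∂(markovChainLaw P μ) ≤
        ∫⁻ ω, H.indicator (fun ω => V (ω (u + 1))) ω ∂(markovChainLaw P μ) := by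
      -- Having hit `S` by time `u` is an event of the path up to `u`, so its indicator passes
      -- through the conditional expectation.
      set H' : Set ((i : Finset.Iic u) → E) := {x | ∃ t, x t ∈ S} with hH'
      have hmH' : MeasurableSet H' := by
        have : H' = ⋃ t, (fun x => x t) ⁻¹' S := by ext; simp [hH']
        rw [this]
        exact MeasurableSet.iUnion fun t => measurable_pi_apply t hS
      have hiff : ∀ ω : ℕ → E, Preorder.frestrictLe (π := fun _ => E) u ω ∈ H' ↔ ω ∈ H := by
        intro ω
        simp only [hH', hH, Set.mem_ofPred_eq, Preorder.frestrictLe_apply, Subtype.exists,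
          Finset.mem_Iic, exists_prop]
      have key := lintegral_markovChainLaw_succ P μ u
        (F := fun q => H'.indicator 1 q.1 * V q.2)
        (((measurable_one.indicator hmH').comp measurable_fst).mul (hV.comp measurable_snd))
      have e1 : ∀ ω : ℕ → E, H'.indicator (1 : ((i : Finset.Iic u) → E) → ℝ≥0∞)
          (Preorder.frestrictLe (π := fun _ => E) u ω) = H.indicator 1 ω := by
        intro ω
        by_cases hc : ω ∈ H
        · rw [Set.indicator_of_mem hc, Set.indicator_of_mem ((hiff ω).2 hc)]; rfl
        · rw [Set.indicator_of_notMem hc,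
            Set.indicator_of_notMem (fun hn => hc ((hiff ω).1 hn))]
      simp only [e1] at key
      have e2 : ∀ (ω : ℕ → E) (c : ℝ≥0∞), H.indicator (1 : (ℕ → E) → ℝ≥0∞) ω * c =
          H.indicator (fun _ => c) ω := by
        intro ω c
        by_cases hc : ω ∈ H <;> simp [hc]
      have e3 : ∀ (ω : ℕ → E) (f : (ℕ → E) → ℝ≥0∞),
          H.indicator f ω = H.indicator (1 : (ℕ → E) → ℝ≥0∞) ω * f ω := by
        intro ω f
        by_cases hc : ω ∈ H <;> simp [hc]
      calc _ = ∫⁻ ω, H.indicator (1 : (ℕ → E) → ℝ≥0∞) ω * V (ω u) ∂(markovChainLaw P μ) := by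
            exact lintegral_congr fun ω => e3 ω _
        _ ≤ ∫⁻ ω, ∫⁻ y, H.indicator (1 : (ℕ → E) → ℝ≥0∞) ω * V y ∂(P (ω u))
              ∂(markovChainLaw P μ) := by
            refine lintegral_mono_ae ?_
            filter_upwards [h.ae_path hμ] with ω hω
            rw [lintegral_const_mul _ hV]
            gcongr
            exact h.indicator_stayBound_le (hω u).1
        _ = ∫⁻ ω, H.indicator (1 : (ℕ → E) → ℝ≥0∞) ω * V (ω (u + 1)) ∂(markovChainLaw P μ) :=
            key.symm
        _ = _ := lintegral_congr fun ω => (e3 ω fun ω => V (ω (u + 1))).symm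
    have hsplit : ∀ ω, ({ω : ℕ → E | ∃ t ≤ u + 1, ω t ∈ S}).indicator
        (fun ω => V (ω (u + 1))) ω = H.indicator (fun ω => V (ω (u + 1))) ω +
          ({ω : ℕ → E | ω (u + 1) ∈ S} \ H).indicator (fun ω => V (ω (u + 1))) ω := by
      intro ω
      rw [hsub, Set.indicator_union_of_disjoint hdisj]
    have hVu : Measurable fun ω : ℕ → E => V (ω (u + 1)) := hV.comp (measurable_pi_apply _)
    simp only [hsplit]
    rw [lintegral_add_left (hVu.indicator (hmeas u)), hsub, measure_union hdisj hmS, mul_add]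
    refine add_le_add (ih.trans hstep) ?_
    rw [← setLIntegral_const, ← lintegral_indicator hmS]
    refine lintegral_mono_ae ?_
    filter_upwards [h.ae_path hμ] with ω hω
    by_cases hmem : ω ∈ {ω : ℕ → E | ω (u + 1) ∈ S} \ H
    · rw [Set.indicator_of_mem hmem, Set.indicator_of_mem hmem]
      exact hVS _ (hω (u + 1)).1 hmem.1
    · rw [Set.indicator_of_notMem hmem, Set.indicator_of_notMem hmem]

/-- If the chain eventually enters `S ⊆ B` whenever it eventually stays in `B`, then the
probability of being in `S` converges, and the limit is the probability of hitting `S`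
up to a factor close to one. -/
theorem exists_tendsto_measure {S : Set E} (hS : MeasurableSet S) {δ : ℝ}
    (hSB : ∀ z, K z → z ∈ S → z ∈ B) (hSδ : ∀ z, K z → z ∈ S → 1 - w z ≤ δ)
    (hev : ∀ ω : ℕ → E, (∀ n, K (ω n) ∧ R (ω n) (ω (n + 1))) → (∀ᶠ n in atTop, ω n ∈ B) →
      ∀ᶠ n in atTop, ω n ∈ S) :
    ∃ L : ℝ≥0∞, Tendsto (fun t : ℕ => ((P ^ t) ∘ₘ μ) S) atTop (𝓝 L) ∧
      L ≤ markovChainLaw P μ {ω | ∃ t, ω t ∈ S} ∧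
      ENNReal.ofReal (stayBound κ δ) * markovChainLaw P μ {ω | ∃ t, ω t ∈ S} ≤ L := by
  have hB := h.measurableSet
  have hE : MeasurableSet {ω : ℕ → E | ∀ᶠ n in atTop, ω n ∈ B} := by
    simp only [eventually_atTop]
    have : {ω : ℕ → E | ∃ a, ∀ b ≥ a, ω b ∈ B} =
        ⋃ a, ⋂ b ∈ Set.Ici a, (fun ω => ω b) ⁻¹' B := by ext; simp
    rw [this]
    exact MeasurableSet.iUnion fun a => MeasurableSet.biInter (Set.to_countable _)
      fun b _ => measurable_pi_apply b hB
  -- Applied both to `S` and to `B`: their occupation probabilities have the same limit, which lets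
  -- the bound at finite horizon be proved for `B` and then read for `S`.
  have hlim : ∀ A : Set E, MeasurableSet A →
      (∀ᵐ ω ∂(markovChainLaw P μ), (∀ᶠ n in atTop, ω n ∈ B) → ∀ᶠ n in atTop, ω n ∈ A) →
      (∀ᵐ ω ∂(markovChainLaw P μ), (∀ᶠ n in atTop, ω n ∉ B) → ∀ᶠ n in atTop, ω n ∉ A) →
      Tendsto (fun t : ℕ => markovChainLaw P μ {ω | ω t ∈ A}) atTop
        (𝓝 (markovChainLaw P μ {ω | ∀ᶠ n in atTop, ω n ∈ B})) := by
    intro A hA h1 h2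
    refine tendsto_measure_of_ae_tendsto_indicator_of_isFiniteMeasure atTop hE
      (fun t => measurable_pi_apply t hA) ?_
    filter_upwards [h1, h2, h.ae_eventually_class hμ] with ω h1 h2 h3
    rcases h3 with h3 | h3
    · filter_upwards [h1 h3] with n hn
      simp [hn, h3]
    · have : ¬ ∀ᶠ n in atTop, ω n ∈ B := fun hc => by
        obtain ⟨n, hn, hn'⟩ := (h3.and hc).exists
        exact hn hn'
      filter_upwards [h2 h3] with n hn
      simp only [hn, this]
  have hmargin : ∀ t : ℕ, ((P ^ t) ∘ₘ μ) S = markovChainLaw P μ {ω | ω t ∈ S} := fun t => by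
    rw [← map_markovChainLaw P μ t, Measure.map_apply (measurable_pi_apply t) hS]; rfl
  have hLS := hlim S hS
    (by filter_upwards [h.ae_path hμ] with ω hω using hev ω hω)
    (by
      filter_upwards [h.ae_path hμ] with ω hω hn
      filter_upwards [hn] with n hn hc using hn (hSB _ (hω n).1 hc))
  have hLB := hlim B hB (ae_of_all _ fun ω hω => hω) (ae_of_all _ fun ω hω => hω)
  refine ⟨_, by simpa only [hmargin] using hLS, ?_, ?_⟩
  · exact le_of_tendsto' hLS fun t => measure_mono fun ω hω => ⟨t, hω⟩
  · have hmono : Monotone fun u : ℕ => {ω : ℕ → E | ∃ t ≤ u, ω t ∈ S} :=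
      fun u v huv ω ⟨t, ht, htS⟩ => ⟨t, ht.trans huv, htS⟩
    have hunion : {ω : ℕ → E | ∃ t, ω t ∈ S} = ⋃ u : ℕ, {ω : ℕ → E | ∃ t ≤ u, ω t ∈ S} := by
      ext ω
      simp only [Set.mem_ofPred_eq, Set.mem_iUnion]
      exact ⟨fun ⟨t, ht⟩ => ⟨t, t, le_rfl, ht⟩, fun ⟨_, t, _, ht⟩ => ⟨t, ht⟩⟩
    have hT := tendsto_measure_iUnion_atTop (μ := markovChainLaw P μ) hmono
    rw [← hunion] at hT
    refine le_of_tendsto_of_tendsto' (ENNReal.Tendsto.const_mul hT (Or.inr ENNReal.ofReal_ne_top))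
      hLB fun u => ?_
    -- The submartingale is at most the indicator of `B`, so the optional stopping bound gives a
    -- lower bound for the probability of being in `B` at time `u`.
    refine (h.mul_measure_hit_le hμ hS hSB hSδ u).trans ?_
    refine le_of_le_of_eq (lintegral_mono_ae ?_)
      (lintegral_indicator_one (measurable_pi_apply u hB))
    filter_upwards [h.ae_path hμ] with ω hω
    refine (Set.indicator_le_self _ _ _).trans ?_
    by_cases hc : ω u ∈ B
    · rw [Set.indicator_of_mem hc, Set.indicator_of_mem (by exact hc)]
      exact ENNReal.ofReal_le_one.2 (stayBound_le_one (by linarith [h.le_one _ (hω u).1]))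
    · rw [Set.indicator_of_notMem hc]; exact zero_le

end IsReinforced

end ReinforcedChain

/-! ### One step of the dynamics, and extinct actions -/

section Step

variable {ι : Type*} [Fintype ι] {A : ι → Type*} [∀ i, Fintype (A i)]

lemma selectProb_of_mem {B : Type*} [Fintype B] {x : B → ℝ} (hx : x ∈ stdSimplex ℝ B) (b : B) :
    selectProb x b = ENNReal.ofReal (x b) := by
  unfold selectProb; rw [if_pos hx]

lemma selectProb_single {B : Type*} [Fintype B] [DecidableEq B] (b c : B) :
    selectProb (Pi.single b 1) c = if c = b then 1 else 0 := by
  rw [selectProb_of_mem (single_mem_stdSimplex ℝ b), Pi.single_apply]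
  split_ifs <;> simp

lemma selectProb_ne_zero_of_profileProb {T : Finset ι} {z : State A} {a : Profile A}
    (h : profileProb T z a ≠ 0) {i : ι} (hi : i ∉ T) :
    selectProb (z.strategy i) (a i) ≠ 0 := by
  unfold profileProb at h
  have := Finset.prod_ne_zero_iff.1 h i (Finset.mem_univ i)
  rwa [if_neg hi] at this

variable [DecidableEq ι] [∀ i, DecidableEq (A i)] [∀ i, MeasurableSpace (A i)]
  [∀ i, MeasurableSingletonClass (A i)]

lemma Model.measurable_next_right (G : Model A) (z : State A) (a : Profile A) :
    Measurable (G.next z a) :=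
  G.measurable_next.comp (measurable_const.prodMk (measurable_const.prodMk measurable_id))

lemma Model.lintegral_step (G : Model A) (N : Kernel (State A × Profile A) (ι → ℝ))
    [IsMarkovKernel N] (T : Finset ι) (z : State A) {f : State A → ℝ≥0∞} (hf : Measurable f) :
    ∫⁻ y, f y ∂(G.step N T z) =
      ∑ a, profileProb T z a * ∫⁻ υ, f (G.next z a υ) ∂(N (z, a)) := by
  have hg : Measurable (fun q : State A × Profile A × (ι → ℝ) => f (G.next q.1 q.2.1 q.2.2)) :=
    hf.comp G.measurable_next
  have hg' : Measurable (fun q : Profile A × (ι → ℝ) => f (G.next z q.1 q.2)) :=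
    hg.comp measurable_prodMk_left
  unfold Model.step
  rw [Kernel.map_apply _ G.measurable_next, lintegral_map hf G.measurable_next,
    Kernel.prod_apply, lintegral_prod _ hg.aemeasurable, Kernel.id_apply,
    lintegral_dirac' _ (hg.lintegral_prod_right'), Kernel.lintegral_compProd _ _ _ hg']
  change ∫⁻ a, _ ∂(∑ a, profileProb T z a • Measure.dirac a) = _
  rw [lintegral_finsetSum_measure]
  refine Finset.sum_congr rfl fun a _ => ?_
  rw [lintegral_smul_measure, smul_eq_mul, lintegral_dirac]

lemma measurableSet_action (a : Profile A) : MeasurableSet {y : State A | y.action = a} :=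
  measurable_fst (measurableSet_singleton a)

lemma Model.step_action (G : Model A) (N : Kernel (State A × Profile A) (ι → ℝ))
    [IsMarkovKernel N] (T : Finset ι) (z : State A) (a : Profile A) :
    G.step N T z {y | y.action = a} = profileProb T z a := by
  classical
  rw [← lintegral_indicator_one (measurableSet_action a),
    G.lintegral_step N T z (measurable_one.indicator (measurableSet_action a)),
    Finset.sum_eq_single a]
  · simp [Set.indicator, Model.next, State.action]
  · intro b _ hb
    simp [Set.indicator, Model.next, State.action, hb]
  · simp

lemma Model.ae_step (G : Model A) (N : Kernel (State A × Profile A) (ι → ℝ))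
    [IsMarkovKernel N] (T : Finset ι) (z : State A) {p : State A → Prop}
    (hp : MeasurableSet {y | p y})
    (h : ∀ a, profileProb T z a ≠ 0 → ∀ᵐ υ ∂(N (z, a)), p (G.next z a υ)) :
    ∀ᵐ y ∂(G.step N T z), p y := by
  change G.step N T z {y | p y}ᶜ = 0
  rw [← lintegral_indicator_one hp.compl,
    G.lintegral_step N T z (measurable_one.indicator hp.compl)]
  refine Finset.sum_eq_zero fun a _ => ?_
  by_cases ha : profileProb T z a = 0
  · rw [ha, zero_mul]
  · refine mul_eq_zero_of_right _ ((lintegral_eq_zero_iff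
      ((measurable_one.indicator hp.compl).comp (G.measurable_next_right z a))).2 ?_)
    filter_upwards [h a ha] with υ hυ
    simp [hυ]

/-- The noise lies in the box `[-b, b]^n` and all measured utilities lie in `(0, 1 / ε)`. -/
def Model.AdmissibleNoise (G : Model A) (b : ℝ) (a : Profile A) (υ : ι → ℝ) : Prop :=
  ∀ i, υ i ∈ Set.Icc (-b) b ∧
    0 < G.ε * G.measuredUtility a υ i ∧ G.ε * G.measuredUtility a υ i < 1

/-- The step size of agent `i` in the update of its strategy. -/
noncomputable def Model.gain (G : Model A) (z : State A) (a : Profile A) (υ : ι → ℝ) (i : ι) : ℝ :=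
  G.ε * G.aspirationFactor (G.measuredUtility a υ i) (G.measuredUtility a υ i - z.aspiration i)

lemma Model.next_strategy (G : Model A) (z : State A) (a : Profile A) (υ : ι → ℝ) (i : ι)
    (b : A i) : (G.next z a υ).strategy i b =
      z.strategy i b + G.gain z a υ i * ((Pi.single (a i) (1 : ℝ) : A i → ℝ) b - z.strategy i b) := by
  unfold Model.gain
  change z.strategy i b + _ * _ * _ = _
  ring

lemma Model.gain_le_one (G : Model A) (hε : 0 < G.ε) (hεh : G.ε * G.h < 1) (hc : 0 < G.c)
    {b : ℝ} {a : Profile A} {υ : ι → ℝ} (h : G.AdmissibleNoise b a υ) (z : State A) (i : ι) :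
    G.gain z a υ i ≤ 1 := by
  obtain ⟨-, -, h1⟩ := h i
  unfold Model.gain Model.aspirationFactor
  split_ifs with hy
  · exact h1.le
  · rw [mul_max_of_nonneg _ _ hε.le]
    refine max_le hεh.le (le_trans ?_ h1.le)
    exact mul_le_mul_of_nonneg_left (by nlinarith) hε.le

/-- A satisfied agent moves by `ε` times its measured utility, a dissatisfied one by at least `ε h`.
This is the source of the contraction constant `κ`. -/
lemma Model.le_gain (G : Model A) (hε : 0 < G.ε)
    {m b : ℝ} (hm : ∀ i a, m ≤ G.u i a) {a : Profile A} {υ : ι → ℝ}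
    (h : G.AdmissibleNoise b a υ) (z : State A) (i : ι) :
    min (G.ε * G.h) (G.ε * (m - b)) ≤ G.gain z a υ i := by
  obtain ⟨⟨h1, -⟩, -⟩ := h i
  unfold Model.gain Model.aspirationFactor
  split_ifs with hy
  · refine (min_le_right _ _).trans (mul_le_mul_of_nonneg_left ?_ hε.le)
    unfold Model.measuredUtility
    linarith [hm i a]
  · exact (min_le_left _ _).trans (mul_le_mul_of_nonneg_left (le_max_left _ _) hε.le)

lemma Model.gain_nonneg (G : Model A) (hε : 0 < G.ε) (hh : 0 < G.h)
    {b : ℝ} {a : Profile A} {υ : ι → ℝ} (h : G.AdmissibleNoise b a υ) (z : State A) (i : ι) :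
    0 ≤ G.gain z a υ i := by
  obtain ⟨-, h0, -⟩ := h i
  unfold Model.gain Model.aspirationFactor
  split_ifs with hy
  · exact h0.le
  · exact mul_nonneg hε.le (hh.le.trans (le_max_left _ _))

/-- The new strategy is a convex combination of the old one and the vertex of the played action. -/
lemma Model.next_strategy_mem_stdSimplex (G : Model A) {z : State A} {a : Profile A} {υ : ι → ℝ}
    {i : ι} (hz : z.strategy i ∈ stdSimplex ℝ (A i)) (h0 : 0 ≤ G.gain z a υ i)
    (h1 : G.gain z a υ i ≤ 1) : (G.next z a υ).strategy i ∈ stdSimplex ℝ (A i) := by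
  have := (convex_stdSimplex ℝ (A i)) hz (single_mem_stdSimplex ℝ (a i))
    (sub_nonneg.2 h1) h0 (sub_add_cancel _ _)
  convert this using 1
  ext b
  rw [G.next_strategy]
  simp only [Pi.add_apply, Pi.smul_apply, smul_eq_mul]
  ring

/-- The states from which agent `j` never again plays the action `b`. -/
def Excludes (j : ι) (b : A j) (z : State A) : Prop :=
  z.strategy j ∈ stdSimplex ℝ (A j) ∧ z.strategy j b = 0 ∧ z.action j ≠ b

lemma Excludes.next {G : Model A} {j : ι} {b : A j} {z : State A}
    (hz : z.strategy j ∈ stdSimplex ℝ (A j)) (hb : z.strategy j b = 0) {a : Profile A}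
    (ha : a j ≠ b) {υ : ι → ℝ} (h0 : 0 ≤ G.gain z a υ j) (h1 : G.gain z a υ j ≤ 1) :
    Excludes j b (G.next z a υ) := by
  refine ⟨G.next_strategy_mem_stdSimplex hz h0 h1, ?_, ha⟩
  rw [G.next_strategy, hb, Pi.single_apply, if_neg (Ne.symm ha)]
  simp

/-- An action of probability zero is not drawn, and an action not drawn gains no weight, so it stays
extinct. The current action must differ from `d` as well, for the case `t = 0`. -/
lemma Model.pow_unperturbed_eq_zero (G : Model A) (hε : 0 < G.ε) (hh : 0 < G.h)
    (hεh : G.ε * G.h < 1) (hc : 0 < G.c) (N : Kernel (State A × Profile A) (ι → ℝ))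
    [IsMarkovKernel N] {b : ℝ} (hN : ∀ z a, ∀ᵐ υ ∂(N (z, a)), G.AdmissibleNoise b a υ)
    {j : ι} {d : A j} {S : Set (State A)} (hS : MeasurableSet S) (hSd : ∀ z ∈ S, z.action j = d)
    (t : ℕ) {z : State A} (hz : Excludes j d z) : (G.unperturbed N ^ t) z S = 0 := by
  induction t generalizing z with
  | zero =>
    rw [pow_zero]
    change Kernel.id z S = 0
    rw [Kernel.id_apply, Measure.dirac_apply' _ hS,
      Set.indicator_of_notMem (fun hc => hz.2.2 (hSd z hc))]
  | succ t ih =>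
    rw [add_comm, Kernel.pow_add_apply_eq_lintegral _ _ _ _ hS, pow_one]
    refine (G.lintegral_step N ∅ z (((G.unperturbed N) ^ t).measurable_coe hS)).trans ?_
    refine Finset.sum_eq_zero fun a _ => ?_
    by_cases ha : profileProb ∅ z a = 0
    · rw [ha, zero_mul]
    · have haj : a j ≠ d := by
        rintro rfl
        have := selectProb_ne_zero_of_profileProb ha (Finset.notMem_empty j)
        -- Membership in the simplex is needed here: otherwise `selectProb` would default to the
        -- uniform, positive value.
        rw [selectProb_of_mem hz.1, hz.2.1] at this
        simp at this
      refine mul_eq_zero_of_right _ ((lintegral_eq_zero_iff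
        ((((G.unperturbed N) ^ t).measurable_coe hS).comp (G.measurable_next_right z a))).2 ?_)
      filter_upwards [hN z a] with υ hυ
      exact ih (Excludes.next hz.1 hz.2.1 haj (G.gain_nonneg hε hh hυ z j)
        (G.gain_le_one hε hεh hc hυ z j))

end Step

/-! ### Reduction of the trembling step to `z'` -/

section Tremble

variable {ι : Type*} [Fintype ι] [DecidableEq ι] {A : ι → Type*} [∀ i, Fintype (A i)]
  [∀ i, DecidableEq (A i)]

/-- If an agent other than `j` trembles, `j` repeats its pure action and the profile of `s'` is
impossible. If `j` trembles, all others repeat theirs, and only the uniform draw of `j` is random.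
-/
lemma sum_profileProb_singleton {G : Model A} {s s' : State A} (hs : G.IsPureStrategyState s)
    {j : ι} (hj : s'.action j ≠ s.action j) (hother : ∀ i, i ≠ j → s'.action i = s.action i) :
    ∑ i, profileProb {i} s s'.action = (Fintype.card (A j) : ℝ≥0∞)⁻¹ := by
  rw [Finset.sum_eq_single j]
  · unfold profileProb
    rw [Finset.prod_eq_single j]
    · simp
    · intro i _ hi
      rw [if_neg (by simpa using hi), (hs i).1, selectProb_single, if_pos (hother i hi)]
    · simp
  · intro i _ hi
    by_contra hne
    have := selectProb_ne_zero_of_profileProb hne (i := j) (by simpa using hi.symm)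
    rw [(hs j).1, selectProb_single, if_neg hj] at this
    exact this rfl
  · simp

/-- If `j` played its action in `s'`, it would have to be the trembling agent. All others would then
repeat their actions, and the profile would be that of `s'`. -/
lemma action_ne_of_profileProb_singleton {G : Model A} {s s' : State A}
    (hs : G.IsPureStrategyState s) {j : ι} (hj : s'.action j ≠ s.action j)
    (hother : ∀ i, i ≠ j → s'.action i = s.action i) {i : ι} {a : Profile A}
    (ha : a ≠ s'.action) (hp : profileProb {i} s a ≠ 0) : a j ≠ s'.action j := by
  have hk : ∀ k, k ≠ i → a k = s.action k := by
    intro k hk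
    have := selectProb_ne_zero_of_profileProb hp (i := k) (by simpa using hk)
    rw [(hs k).1, selectProb_single] at this
    by_contra hc
    rw [if_neg hc] at this
    exact this rfl
  intro hc
  by_cases hij : j = i
  · subst hij
    refine ha (funext fun k => ?_)
    by_cases hkj : k = j
    · subst hkj; exact hc
    · rw [hk k hkj, hother k hkj]
  · exact hj (hc.symm.trans (hk j hij))

lemma tremble_weight {s : State A} (j : ι) {γ : ℝ}
    (hγ : γ = 1 / ((Fintype.card ι : ℝ) * (Fintype.card (A j) : ℝ))) :
    (Fintype.card ι : ℝ≥0∞)⁻¹ * (Fintype.card (A j) : ℝ≥0∞)⁻¹ = ENNReal.ofReal γ := by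
  have hn : 0 < Fintype.card ι := Fintype.card_pos_iff.2 ⟨j⟩
  have hm : 0 < Fintype.card (A j) := Fintype.card_pos_iff.2 ⟨s.action j⟩
  rw [hγ, one_div, mul_inv, ENNReal.ofReal_mul (by positivity),
    ENNReal.ofReal_inv_of_pos (by exact_mod_cast hn),
    ENNReal.ofReal_inv_of_pos (by exact_mod_cast hm), ENNReal.ofReal_natCast,
    ENNReal.ofReal_natCast]

variable [∀ i, MeasurableSpace (A i)] [∀ i, MeasurableSingletonClass (A i)]

lemma Model.oneTremble_action (G : Model A) (N : Kernel (State A × Profile A) (ι → ℝ))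
    [IsMarkovKernel N] {s s' : State A} (hs : G.IsPureStrategyState s)
    {j : ι} (hj : s'.action j ≠ s.action j) (hother : ∀ i, i ≠ j → s'.action i = s.action i)
    {γ : ℝ} (hγ : γ = 1 / ((Fintype.card ι : ℝ) * (Fintype.card (A j) : ℝ))) :
    (G.oneTremble N s).real {z | z.action = s'.action} = γ := by
  have hγ0 : 0 ≤ γ := by rw [hγ]; positivity
  have : (G.oneTremble N s) {z | z.action = s'.action} = ENNReal.ofReal γ := by
    change ((Fintype.card ι : ℝ≥0∞)⁻¹ • ∑ i, G.step N {i} s) _ = _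
    simp only [Measure.smul_apply, Measure.coe_finsetSum, Finset.sum_apply, smul_eq_mul,
      G.step_action]
    rw [sum_profileProb_singleton hs hj hother, tremble_weight (s := s) j hγ]
  rw [measureReal_def, this, ENNReal.toReal_ofReal hγ0]

/-- The first-step profiles other than that of `s'` leave the action of `j` in `s'` extinct and
contribute exactly zero. Thus the factor `γ` is exact, and all the asymptotics concern the chain
started at `z'`. -/
lemma Model.trembleThen_eq (G : Model A) (hε : 0 < G.ε) (hh : 0 < G.h)
    (hεh : G.ε * G.h < 1) (hc : 0 < G.c) (N : Kernel (State A × Profile A) (ι → ℝ))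
    [IsMarkovKernel N] {b : ℝ} (hN : ∀ z a, ∀ᵐ υ ∂(N (z, a)), G.AdmissibleNoise b a υ)
    {s s' : State A} (hs : G.IsPureStrategyState s)
    {j : ι} (hj : s'.action j ≠ s.action j) (hother : ∀ i, i ≠ j → s'.action i = s.action i)
    {γ : ℝ} (hγ : γ = 1 / ((Fintype.card ι : ℝ) * (Fintype.card (A j) : ℝ)))
    {S : Set (State A)} (hS : MeasurableSet S) (hSa : ∀ z ∈ S, z.action = s'.action) (t : ℕ) :
    G.trembleThen N t s S =
      γ * ((G.unperturbed N ^ t) ∘ₘ (G.afterPlaying N s s'.action)).real S := by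
  have hγ0 : 0 ≤ γ := by rw [hγ]; positivity
  have hf : Measurable fun y => (G.unperturbed N ^ t) y S := (G.unperturbed N ^ t).measurable_coe hS
  unfold Model.trembleThen
  rw [measureReal_def, measureReal_def, ← ENNReal.toReal_ofReal hγ0, ← ENNReal.toReal_mul]
  congr 1
  rw [Kernel.comp_apply' _ _ _ hS, Measure.bind_apply hS (Kernel.aemeasurable _)]
  change ∫⁻ y, _ ∂((Fintype.card ι : ℝ≥0∞)⁻¹ • ∑ i, G.step N {i} s) = _
  rw [lintegral_smul_measure, lintegral_finsetSum_measure]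
  unfold Model.afterPlaying
  rw [lintegral_map hf (G.measurable_next_right s s'.action), ← tremble_weight (s := s) j hγ,
    ← sum_profileProb_singleton hs hj hother, smul_eq_mul, mul_assoc, Finset.sum_mul]
  congr 1
  refine Finset.sum_congr rfl fun i _ => ?_
  rw [G.lintegral_step N {i} s hf]
  refine Finset.sum_eq_single s'.action (fun a _ ha => ?_) (by simp)
  by_cases hp : profileProb {i} s a = 0
  · rw [hp, zero_mul]
  refine mul_eq_zero_of_right _
    ((lintegral_eq_zero_iff (hf.comp (G.measurable_next_right s a))).2 ?_)
  filter_upwards [hN s a] with υ hυ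
  refine G.pow_unperturbed_eq_zero hε hh hεh hc N hN hS
    (d := s'.action j) (fun z hz => by rw [hSa z hz]) t (Excludes.next ?_ ?_
      (action_ne_of_profileProb_singleton hs hj hother ha hp) (G.gain_nonneg hε hh hυ s j)
        (G.gain_le_one hε hεh hc hυ s j))
  · rw [(hs j).1]; exact single_mem_stdSimplex ℝ _
  · rw [(hs j).1, Pi.single_apply, if_neg hj]

end Tremble

/-! ### The chain from `z'` as a reinforced two-class chain -/

section Mixture

variable {ι : Type*} [Fintype ι] [DecidableEq ι] {A : ι → Type*} [∀ i, Fintype (A i)]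
  [∀ i, DecidableEq (A i)] [∀ i, MeasurableSpace (A i)] [∀ i, MeasurableSingletonClass (A i)]

/-- `y` is a successor of `z` under admissible noise. -/
def Model.Succ (G : Model A) (b : ℝ) (z y : State A) : Prop :=
  (∀ i c, y.strategy i c = (G.next z y.action y.noise).strategy i c) ∧
  (∀ i, y.aspiration i = (G.next z y.action y.noise).aspiration i) ∧
  G.AdmissibleNoise b y.action y.noise

/-- Agent `j` mixes between its actions in the profiles `a` and `a'`, all other agents play
according to `a`, and the last action of agent `j` has at least probability `κ`. -/
def IsMixture (a a' : Profile A) (j : ι) (κ : ℝ) (z : State A) : Prop :=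
  (z.action = a ∨ z.action = a') ∧ (∀ k, k ≠ j → z.strategy k = Pi.single (a k) 1) ∧
  (∀ c, z.strategy j c = z.strategy j (a' j) * (Pi.single (a' j) (1 : ℝ) : A j → ℝ) c +
    (1 - z.strategy j (a' j)) * (Pi.single (a j) (1 : ℝ) : A j → ℝ) c) ∧
  κ ≤ z.strategy j (z.action j) ∧ 0 ≤ z.strategy j (a' j) ∧ z.strategy j (a' j) ≤ 1

namespace IsMixture

variable {a a' : Profile A} {j : ι} {κ : ℝ} {z : State A}

lemma mem_stdSimplex (h : IsMixture a a' j κ z) (i : ι) : z.strategy i ∈ stdSimplex ℝ (A i) := by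
  obtain ⟨-, h2, h3, -, h5, h6⟩ := h
  by_cases hi : i = j
  · subst hi
    have := (convex_stdSimplex ℝ (A i)) (single_mem_stdSimplex ℝ (a' i))
      (single_mem_stdSimplex ℝ (a i)) h5 (sub_nonneg.2 h6) (add_sub_cancel _ _)
    convert this using 1
    ext c
    rw [h3 c]; rfl
  · rw [h2 i hi]; exact single_mem_stdSimplex ℝ _

lemma strategy_left (h : IsMixture a a' j κ z) (hj : a' j ≠ a j) :
    z.strategy j (a j) = 1 - z.strategy j (a' j) := by
  rw [h.2.2.1 (a j), Pi.single_eq_same, Pi.single_eq_of_ne hj.symm]; ring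

lemma action_of_profileProb (h : IsMixture a a' j κ z) (hother : ∀ k, k ≠ j → a' k = a k)
    {d : Profile A} (hd : profileProb ∅ z d ≠ 0) : d = a ∨ d = a' := by
  have hk : ∀ k, k ≠ j → d k = a k := by
    intro k hk
    have := selectProb_ne_zero_of_profileProb hd (Finset.notMem_empty k)
    rw [h.2.1 k hk, selectProb_single] at this
    by_contra hc
    rw [if_neg hc] at this
    exact this rfl
  have hdj : d j = a j ∨ d j = a' j := by
    by_contra! hc
    have := selectProb_ne_zero_of_profileProb hd (Finset.notMem_empty j)
    rw [selectProb_of_mem (h.mem_stdSimplex j), h.2.2.1, Pi.single_eq_of_ne hc.1,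
      Pi.single_eq_of_ne hc.2] at this
    simp at this
  rcases hdj with hdj | hdj
  · refine Or.inl (funext fun k => ?_)
    by_cases hkj : k = j
    · subst hkj; exact hdj
    · exact hk k hkj
  · refine Or.inr (funext fun k => ?_)
    by_cases hkj : k = j
    · subst hkj; exact hdj
    · rw [hk k hkj, hother k hkj]

lemma profileProb_right (h : IsMixture a a' j κ z) (hother : ∀ k, k ≠ j → a' k = a k) :
    profileProb ∅ z a' = ENNReal.ofReal (z.strategy j (a' j)) := by
  unfold profileProb
  rw [Finset.prod_eq_single j]
  · rw [if_neg (Finset.notMem_empty j), selectProb_of_mem (h.mem_stdSimplex j)]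
  · intro k _ hk
    rw [if_neg (Finset.notMem_empty k), h.2.1 k hk, selectProb_single, if_pos (hother k hk)]
  · simp

variable {G : Model A} {b : ℝ} {y : State A}

lemma weight_succ (hR : G.Succ b z y) :
    y.strategy j (a' j) = z.strategy j (a' j) + G.gain z y.action y.noise j *
      ((Pi.single (y.action j) (1 : ℝ) : A j → ℝ) (a' j) - z.strategy j (a' j)) := by
  rw [hR.1, G.next_strategy]

lemma one_sub_weight_succ (hR : G.Succ b z y) (hy : y.action = a') :
    1 - y.strategy j (a' j) =
      (1 - G.gain z y.action y.noise j) * (1 - z.strategy j (a' j)) := by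
  rw [weight_succ hR, hy, Pi.single_eq_same]; ring

lemma weight_succ_left (hj : a' j ≠ a j) (hR : G.Succ b z y) (hy : y.action = a) :
    y.strategy j (a' j) = (1 - G.gain z y.action y.noise j) * z.strategy j (a' j) := by
  rw [weight_succ hR, hy, Pi.single_eq_of_ne hj]; ring

/-- The other agents repeat pure actions and do not move. With gain `g`, the played action of `j`
gets the weight `(1 - g) x + g ≥ g ≥ κ`, which keeps the lower bound on the last action. -/
lemma succ (h : IsMixture a a' j κ z) (hj : a' j ≠ a j) (hother : ∀ k, k ≠ j → a' k = a k)
    (hR : G.Succ b z y) (hy : y.action = a ∨ y.action = a') (hκ : 0 ≤ κ)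
    (h0 : κ ≤ G.gain z y.action y.noise j) (h1 : G.gain z y.action y.noise j ≤ 1) :
    IsMixture a a' j κ y := by
  have hl := h.strategy_left hj
  obtain ⟨-, h2, h3, -, h5, h6⟩ := h
  have hform : ∀ c, y.strategy j c =
      y.strategy j (a' j) * (Pi.single (a' j) (1 : ℝ) : A j → ℝ) c +
      (1 - y.strategy j (a' j)) * (Pi.single (a j) (1 : ℝ) : A j → ℝ) c := by
    intro c
    rcases hy with hy | hy
    · rw [weight_succ_left hj hR hy, hR.1, G.next_strategy, h3 c, hy]; ring
    · have e := one_sub_weight_succ (j := j) hR hy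
      have e' : y.strategy j (a' j) =
        1 - (1 - G.gain z y.action y.noise j) * (1 - z.strategy j (a' j)) := by linarith
      rw [e', hR.1, G.next_strategy, h3 c, hy]; ring
  refine ⟨hy, fun k hk => ?_, hform, ?_⟩
  · ext c
    have : y.action k = a k := by
      rcases hy with hy | hy
      · rw [hy]
      · rw [hy, hother k hk]
    rw [hR.1, G.next_strategy, this, h2 k hk, sub_self, mul_zero, add_zero]
  · rcases hy with hy | hy
    · have e := weight_succ_left (j := j) hj hR hy
      have e2 := hform (a j)
      rw [Pi.single_eq_same, Pi.single_eq_of_ne hj.symm] at e2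
      rw [hy] at e h0 h1 ⊢
      refine ⟨?_, ?_, ?_⟩ <;> nlinarith
    · have e := one_sub_weight_succ (j := j) hR hy
      rw [hy] at e h0 h1 ⊢
      refine ⟨?_, ?_, ?_⟩ <;> nlinarith

end IsMixture

lemma Model.measurableSet_succ (G : Model A) (b : ℝ) (a a' : Profile A) :
    MeasurableSet {q : State A × State A |
      G.Succ b q.1 q.2 ∧ (q.2.action = a ∨ q.2.action = a')} := by
  have hn : Measurable fun q : State A × State A => G.next q.1 q.2.action q.2.noise :=
    G.measurable_next.comp (measurable_fst.prodMk
      ((measurable_fst.comp measurable_snd).prodMk (by fun_prop)))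
  have hs : ∀ i c, Measurable fun z : State A => z.strategy i c := fun i c => by
    unfold State.strategy; fun_prop
  have hr : ∀ i, Measurable fun z : State A => z.aspiration i := fun i => by
    unfold State.aspiration; fun_prop
  have hυ : ∀ i, Measurable fun z : State A => z.noise i := fun i => by
    unfold State.noise; fun_prop
  have hm : ∀ i, Measurable fun z : State A => G.ε * G.measuredUtility z.action z.noise i :=
    fun i => by
      unfold Model.measuredUtility
      exact (((measurable_of_countable (G.u i)).comp measurable_fst).add (hυ i)).const_mul _
  have ha : ∀ a : Profile A, MeasurableSet {q : State A × State A | q.2.action = a} :=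
    fun a => measurable_snd (measurableSet_action a)
  refine measurableSet_setOfPred.2 (Measurable.and (Measurable.and ?_ (Measurable.and ?_ ?_))
    (Measurable.or (measurableSet_setOfPred.1 (ha a)) (measurableSet_setOfPred.1 (ha a'))))
  · exact Measurable.forall fun i => Measurable.forall fun c => measurableSet_setOfPred.1
      (measurableSet_eq_fun ((hs i c).comp measurable_snd) ((hs i c).comp hn))
  · exact Measurable.forall fun i => measurableSet_setOfPred.1
      (measurableSet_eq_fun ((hr i).comp measurable_snd) ((hr i).comp hn))
  · refine Measurable.forall fun i => Measurable.and (Measurable.and ?_ ?_) (Measurable.and ?_ ?_)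
    · exact measurableSet_setOfPred.1
        (measurableSet_le measurable_const ((hυ i).comp measurable_snd))
    · exact measurableSet_setOfPred.1
        (measurableSet_le ((hυ i).comp measurable_snd) measurable_const)
    · exact measurableSet_setOfPred.1
        (measurableSet_lt measurable_const ((hm i).comp measurable_snd))
    · exact measurableSet_setOfPred.1
        (measurableSet_lt ((hm i).comp measurable_snd) measurable_const)

/-- Since only `j` randomizes, its weight on `a' j` is the probability of playing `a'` next. The
played action's complementary weight is multiplied by one minus the gain, hence by at most `1 - κ`.
-/
lemma Model.isReinforced (G : Model A) (N : Kernel (State A × Profile A) (ι → ℝ))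
    [IsMarkovKernel N] {b κ : ℝ} (hN : ∀ z a, ∀ᵐ υ ∂(N (z, a)), G.AdmissibleNoise b a υ)
    (hκ0 : 0 < κ) (hκ1 : κ < 1)
    (hgain : ∀ z a υ i, G.AdmissibleNoise b a υ → κ ≤ G.gain z a υ i ∧ G.gain z a υ i ≤ 1)
    {a a' : Profile A} {j : ι} (hj : a' j ≠ a j) (hother : ∀ k, k ≠ j → a' k = a k) :
    IsReinforced (G.unperturbed N) (IsMixture a a' j κ)
      (fun z y => G.Succ b z y ∧ (y.action = a ∨ y.action = a'))
      {y | y.action = a'} (fun z => z.strategy j (a' j)) κ where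
  pos := hκ0
  lt_one := hκ1
  measurableSet := measurableSet_action a'
  measurable := by unfold State.strategy; fun_prop
  measurableSet_rel := G.measurableSet_succ b a a'
  prob z hz := (G.step_action N ∅ z a').trans (hz.profileProb_right hother)
  ae_rel z hz := by
    refine G.ae_step N ∅ z (measurable_prodMk_left (G.measurableSet_succ b a a')) fun d hd => ?_
    filter_upwards [hN z d] with υ hυ
    exact ⟨⟨fun _ _ => rfl, fun _ => rfl, hυ⟩, hz.action_of_profileProb hother hd⟩
  invariant z y hz hR := hz.succ hj hother hR.1 hR.2 hκ0.le
    (hgain z _ _ j hR.1.2.2).1 (hgain z _ _ j hR.1.2.2).2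
  nonneg z hz := hz.2.2.2.2.1
  le_one z hz := hz.2.2.2.2.2
  le_of_mem z hz hB := by
    have := hz.2.2.2.1
    rwa [show z.action = a' from hB] at this
  le_of_notMem z hz hB := by
    have h1 := hz.2.2.2.1
    rw [hz.1.resolve_right hB, hz.strategy_left hj] at h1
    linarith
  step_mem z y hz hR hB := by
    rw [IsMixture.one_sub_weight_succ hR.1 hB]
    exact mul_le_mul_of_nonneg_right (by linarith [(hgain z _ _ j hR.1.2.2).1])
      (by linarith [hz.2.2.2.2.2])
  step_notMem z y hz hR hB := by
    rw [IsMixture.weight_succ_left hj hR.1 (hR.2.resolve_right hB)]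
    exact mul_le_mul_of_nonneg_right (by linarith [(hgain z _ _ j hR.1.2.2).1]) hz.2.2.2.2.1

end Mixture

/-! ### Eventual entry into the neighbourhood -/

section Neighbourhood

variable {ι : Type*} [Fintype ι] [DecidableEq ι] {A : ι → Type*} [∀ i, Fintype (A i)]
  [∀ i, DecidableEq (A i)] [∀ i, MeasurableSpace (A i)] [∀ i, MeasurableSingletonClass (A i)]

lemma norm_toLp_mono (p : ℝ≥0∞) [Fact (1 ≤ p)] {x y : ι → ℝ} (h : ∀ i, |x i| ≤ |y i|) :
    ‖WithLp.toLp p x‖ ≤ ‖WithLp.toLp p y‖ := by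
  rcases eq_or_ne p ∞ with rfl | hp
  · rw [PiLp.norm_eq_ciSup, PiLp.norm_eq_ciSup]
    exact ciSup_mono (Set.finite_range _).bddAbove h
  · have hp0 : 0 < p.toReal :=
      ENNReal.toReal_pos (zero_lt_one.trans_le (Fact.out : 1 ≤ p)).ne' hp
    rw [PiLp.norm_eq_sum hp0, PiLp.norm_eq_sum hp0]
    exact Real.rpow_le_rpow (Finset.sum_nonneg fun i _ => by positivity)
      (Finset.sum_le_sum fun i _ => Real.rpow_le_rpow (norm_nonneg _) (h i) hp0.le)
      (by positivity)

lemma measurableSet_nbhd (p : ℝ≥0∞) [Fact (1 ≤ p)] (δ : ℝ) (s : State A) :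
    MeasurableSet (nbhd p δ s) := by
  refine (measurableSet_action s.action).inter (MeasurableSet.inter ?_ ?_)
  · refine measurableSet_lt (Measurable.norm ((WithLp.measurable_toLp p _).comp ?_))
      measurable_const
    refine measurable_pi_lambda _ fun k => ?_
    unfold State.strategy; fun_prop
  · refine measurableSet_lt (Measurable.norm ((WithLp.measurable_toLp p _).comp ?_))
      measurable_const
    refine measurable_pi_lambda _ fun k => ?_
    unfold State.aspiration; fun_prop

lemma one_sub_le_of_mem_nbhd {G : Model A} {p : ℝ≥0∞} [Fact (1 ≤ p)] {δ : ℝ} {s' z : State A}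
    (hs' : G.IsPureStrategyState s') (j : ι) (hz : z ∈ nbhd p δ s') :
    1 - z.strategy j (s'.action j) ≤ δ := by
  have h1 := (PiLp.norm_apply_le (WithLp.toLp p
    (fun k : (i : ι) × A i => z.strategy k.1 k.2 - s'.strategy k.1 k.2))
      ⟨j, s'.action j⟩).trans hz.2.1.le
  rw [PiLp.toLp_apply, (hs' j).1, Pi.single_eq_same, Real.norm_eq_abs] at h1
  linarith [neg_abs_le (z.strategy j (s'.action j) - 1)]

/-- A sequence contracting towards a level `η < δ` eventually falls below `δ`. -/
lemma eventually_lt_of_contraction {v : ℕ → ℝ} {θ η δ : ℝ} (h0 : 0 < θ) (h1 : θ < 1)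
    (hη : η < δ) (hv : ∀ᶠ n in atTop, v (n + 1) ≤ (1 - θ) * v n + θ * η) :
    ∀ᶠ n in atTop, v n < δ := by
  obtain ⟨n0, hn0⟩ := eventually_atTop.1 hv
  have hb : ∀ k, v (n0 + k) - η ≤ (1 - θ) ^ k * (v n0 - η) := by
    intro k
    induction k with
    | zero => simp
    | succ k ih =>
      have := hn0 (n0 + k) (by omega)
      rw [pow_succ', mul_assoc]
      have := mul_le_mul_of_nonneg_left ih (show 0 ≤ 1 - θ by linarith)
      rw [← add_assoc]
      linarith
  have ht : Tendsto (fun k : ℕ => (1 - θ) ^ k * (v n0 - η)) atTop (𝓝 0) := by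
    simpa using (tendsto_pow_atTop_nhds_zero_of_lt_one (by linarith)
      (show 1 - θ < 1 by linarith)).mul_const (v n0 - η)
  obtain ⟨k0, hk0⟩ := eventually_atTop.1 (ht.eventually_lt_const (sub_pos.2 hη))
  refine eventually_atTop.2 ⟨n0 + k0, fun n hn => ?_⟩
  obtain ⟨k, rfl⟩ := Nat.exists_eq_add_of_le (show n0 ≤ n by omega)
  have := hk0 k (by omega)
  linarith [hb k]

lemma tendsto_zero_of_contraction {v : ℕ → ℝ} {θ : ℝ} (h0 : 0 < θ) (h1 : θ < 1)
    (hpos : ∀ n, 0 ≤ v n) (hv : ∀ᶠ n in atTop, v (n + 1) ≤ (1 - θ) * v n) :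
    Tendsto v atTop (𝓝 0) := by
  refine tendsto_order.2 ⟨fun c hc => Eventually.of_forall fun n => hc.trans_le (hpos n),
    fun c hc => eventually_lt_of_contraction h0 h1 hc ?_⟩
  simpa using hv

/-- Once the profile of `s'` is always played, the strategies converge to those of `s'`. The
aspirations need not converge, since the noise persists; they contract towards the ball of the noise
radius, which is strictly smaller than `δ`. -/
lemma eventually_mem_nbhd {G : Model A} (hεν0 : 0 < G.ε * G.ν) (hεν : G.ε * G.ν < 1)
    {p : ℝ≥0∞} [Fact (1 ≤ p)] {b κ δ : ℝ} (hδ : 0 < δ)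
    (hb : ‖WithLp.toLp p (fun _ : ι => b)‖ < δ) (hκ0 : 0 < κ) (hκ1 : κ < 1)
    (hgain : ∀ z a υ i, G.AdmissibleNoise b a υ → κ ≤ G.gain z a υ i)
    {a : Profile A} {s' : State A} (hs' : G.IsPureStrategyState s') {j : ι}
    (hother : ∀ k, k ≠ j → s'.action k = a k) {ω : ℕ → State A}
    (hω : ∀ n, IsMixture a s'.action j κ (ω n) ∧ G.Succ b (ω n) (ω (n + 1)))
    (hev : ∀ᶠ n in atTop, (ω n).action = s'.action) :
    ∀ᶠ n in atTop, ω n ∈ nbhd p δ s' := by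
  have hev' : ∀ᶠ n in atTop, (ω (n + 1)).action = s'.action :=
    (tendsto_add_atTop_nat 1).eventually hev
  have hw : Tendsto (fun n => 1 - (ω n).strategy j (s'.action j)) atTop (𝓝 0) := by
    refine tendsto_zero_of_contraction hκ0 hκ1
      (fun n => by linarith [(hω n).1.2.2.2.2.2]) ?_
    filter_upwards [hev'] with n hn
    rw [IsMixture.one_sub_weight_succ (hω n).2 hn]
    exact mul_le_mul_of_nonneg_right (by linarith [hgain (ω n) _ _ j (hω n).2.2.2])
      (by linarith [(hω n).1.2.2.2.2.2])
  have hx : Tendsto (fun n => ‖WithLp.toLp p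
      (fun k : (i : ι) × A i => (ω n).strategy k.1 k.2 - s'.strategy k.1 k.2)‖) atTop (𝓝 0) := by
    have hcoord : Tendsto (fun n => fun k : (i : ι) × A i =>
        (ω n).strategy k.1 k.2 - s'.strategy k.1 k.2) atTop (𝓝 0) := by
      rw [tendsto_pi_nhds]
      rintro ⟨i, c⟩
      by_cases hi : i = j
      · subst hi
        have := hw.mul_const ((Pi.single (a i) (1 : ℝ) : A i → ℝ) c -
          (Pi.single (s'.action i) (1 : ℝ) : A i → ℝ) c)
        rw [zero_mul] at this
        refine this.congr fun n => ?_
        simp only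
        rw [(hω n).1.2.2.1 c, (hs' i).1]
        ring
      · refine tendsto_const_nhds.congr fun n => ?_
        simp only
        rw [(hω n).1.2.1 i hi, (hs' i).1, hother i hi, sub_self]; rfl
    have := (((PiLp.continuous_toLp p (fun _ : (i : ι) × A i => ℝ)).tendsto 0).comp hcoord).norm
    simpa using this
  have hρ : ∀ᶠ n in atTop, ‖WithLp.toLp p
      (fun i : ι => (ω n).aspiration i - s'.aspiration i)‖ < δ := by
    refine eventually_lt_of_contraction hεν0 hεν hb ?_
    filter_upwards [hev'] with n hn
    -- As `s'.aspiration` is the nominal utility of the played profile, the new deviation is a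
    -- convex combination of the old deviation and the noise vector.
    have e : WithLp.toLp p (fun i : ι => (ω (n + 1)).aspiration i - s'.aspiration i) =
        (1 - G.ε * G.ν) • WithLp.toLp p (fun i : ι => (ω n).aspiration i - s'.aspiration i) +
          (G.ε * G.ν) • WithLp.toLp p (ω (n + 1)).noise := by
      ext i
      simp only [PiLp.add_apply, PiLp.smul_apply, smul_eq_mul]
      rw [(hω n).2.2.1 i, (hs' i).2, hn]
      change (ω n).aspiration i + G.ε * G.ν * ((G.u i s'.action + (ω (n + 1)).noise i) -
        (ω n).aspiration i) - _ = _
      ring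
    have hnoise : ‖WithLp.toLp p (ω (n + 1)).noise‖ ≤ ‖WithLp.toLp p (fun _ : ι => b)‖ :=
      norm_toLp_mono p fun i => by
        obtain ⟨⟨h1, h2⟩, -⟩ := (hω n).2.2.2 i
        exact (abs_le.2 ⟨h1, h2⟩).trans (le_abs_self b)
    rw [e]
    refine (norm_add_le _ _).trans ?_
    rw [norm_smul, norm_smul, Real.norm_of_nonneg hεν0.le,
      Real.norm_of_nonneg (show 0 ≤ 1 - G.ε * G.ν by linarith)]
    gcongr
  filter_upwards [hev, hx.eventually_lt_const hδ, hρ] with n h1 h2 h3 using ⟨h1, h2, h3⟩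

end Neighbourhood

/-! ### The two-sided bound at fixed `δ` -/

section Approximation

variable {ι : Type*} [Fintype ι] [DecidableEq ι] {A : ι → Type*} [∀ i, Fintype (A i)]
  [∀ i, DecidableEq (A i)] [∀ i, MeasurableSpace (A i)] [∀ i, MeasurableSingletonClass (A i)]

lemma Model.breveP_eq (G : Model A) (N : Kernel (State A × Profile A) (ι → ℝ))
    [IsMarkovKernel N] (p : ℝ≥0∞) (δ : ℝ) (s s' : State A) :
    G.breveP N p δ s s' = (markovChainLaw (G.unperturbed N)
      (G.afterPlaying N s s'.action)).real {ω | ∃ t, ω t ∈ nbhd p δ s'} := by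
  unfold Model.breveP
  congr 1
  ext ω
  rw [Set.mem_ofPred_eq, Set.mem_ofPred_eq, lt_top_iff_ne_top, ne_eq, hittingAfter_eq_top_iff]
  simp

/-- The state `s` is the degenerate mixture with weight zero on `a' j`; `z'` is then a mixture as a
successor of `s`. -/
lemma Model.IsPureStrategyState.isMixture {G : Model A} {s : State A}
    (hs : G.IsPureStrategyState s) {a' : Profile A} {j : ι} (hj : a' j ≠ s.action j) {κ : ℝ}
    (hκ : κ ≤ 1) : IsMixture s.action a' j κ s := by
  refine ⟨Or.inl rfl, fun k _ => (hs k).1, fun c => ?_, ?_⟩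
  · rw [(hs j).1, Pi.single_eq_of_ne hj]; ring
  · rw [(hs j).1, Pi.single_eq_of_ne hj, Pi.single_eq_same]
    exact ⟨hκ, le_rfl, zero_le_one⟩

lemma Model.exists_tendsto_trembleThen (G : Model A)
    (hε : 0 < G.ε) (hν : 0 < G.ν) (hεν : G.ε * G.ν < 1)
    (hh : 0 < G.h) (hεh : G.ε * G.h < 1) (hc : 0 < G.c) (p : ℝ≥0∞) [Fact (1 ≤ p)]
    (N : Kernel (State A × Profile A) (ι → ℝ)) [IsMarkovKernel N] {b m δ : ℝ} (hδ : 0 < δ)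
    (hb : ‖WithLp.toLp p (fun _ : ι => b)‖ < δ) (hm : ∀ i a, 2 * m ≤ G.u i a) (hm0 : 0 < m)
    (hδm : δ ≤ m)
    (hN : ∀ z a, ∀ᵐ υ ∂(N (z, a)), G.AdmissibleNoise b a υ)
    {s s' : State A} (hs : G.IsPureStrategyState s) (hs' : G.IsPureStrategyState s')
    {j : ι} (hj : s'.action j ≠ s.action j) (hother : ∀ i, i ≠ j → s'.action i = s.action i)
    {γ : ℝ} (hγ : γ = 1 / ((Fintype.card ι : ℝ) * (Fintype.card (A j) : ℝ))) :
    ∃ L : ℝ, Tendsto (fun t : ℕ => G.trembleThen N t s (nbhd p δ s')) atTop (𝓝 (γ * L)) ∧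
      L ≤ G.breveP N p δ s s' ∧
      stayBound (min (G.ε * G.h) (G.ε * m)) δ * G.breveP N p δ s s' ≤ L := by
  set κ := min (G.ε * G.h) (G.ε * m) with hκ
  have hκ0 : 0 < κ := lt_min (mul_pos hε hh) (mul_pos hε hm0)
  have hκ1 : κ < 1 := (min_le_left _ _).trans_lt hεh
  -- Noise at most `m` leaves every measured utility at least `m`, so `κ` does not depend on `δ`.
  have hbm : b ≤ m := by
    have := (PiLp.norm_apply_le (WithLp.toLp p (fun _ : ι => b)) j).trans hb.le
    rw [PiLp.toLp_apply, Real.norm_eq_abs] at this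
    exact (le_abs_self b).trans (this.trans hδm)
  have hgain : ∀ (z : State A) a υ i, G.AdmissibleNoise b a υ →
      κ ≤ G.gain z a υ i ∧ G.gain z a υ i ≤ 1 := fun z a υ i hυ =>
    ⟨(min_le_min_left _ (mul_le_mul_of_nonneg_left (by linarith) hε.le)).trans
      (G.le_gain hε hm hυ z i), G.gain_le_one hε hεh hc hυ z i⟩
  have hreinf := G.isReinforced N hN hκ0 hκ1 hgain hj hother
  have hnext := G.measurable_next_right s s'.action
  have : IsProbabilityMeasure (G.afterPlaying N s s'.action) :=
    Measure.isProbabilityMeasure_map hnext.aemeasurable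
  have hμ : ∀ᵐ z ∂(G.afterPlaying N s s'.action), IsMixture s.action s'.action j κ z := by
    have hR : ∀ᵐ z ∂(G.afterPlaying N s s'.action),
        G.Succ b s z ∧ (z.action = s.action ∨ z.action = s'.action) := by
      refine (ae_map_iff hnext.aemeasurable
        (measurable_prodMk_left (G.measurableSet_succ b s.action s'.action))).2 ?_
      filter_upwards [hN s s'.action] with υ hυ
      exact ⟨⟨fun _ _ => rfl, fun _ => rfl, hυ⟩, Or.inr rfl⟩
    filter_upwards [hR] with z hz
    exact hreinf.invariant s z (hs.isMixture hj hκ1.le) hz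
  have hmeas := measurableSet_nbhd p δ s'
  obtain ⟨L, hL, hle, hge⟩ := hreinf.exists_tendsto_measure hμ hmeas (δ := δ)
    (fun z _ hz => hz.1) (fun z _ hz => one_sub_le_of_mem_nbhd hs' j hz)
    (fun ω hω hev => eventually_mem_nbhd (mul_pos hε hν) hεν hδ hb hκ0 hκ1
      (fun z a υ i hυ => (hgain z a υ i hυ).1) hs' hother
      (fun n => ⟨(hω n).1, (hω n).2.1⟩) hev)
  have hLtop : L ≠ ∞ := (hle.trans_lt (measure_lt_top _ _)).ne
  refine ⟨L.toReal, ?_, ?_, ?_⟩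
  · have := ((ENNReal.tendsto_toReal hLtop).comp hL).const_mul γ
    refine this.congr fun t => ?_
    rw [G.trembleThen_eq hε hh hεh hc N hN hs hj hother hγ hmeas (fun z hz => hz.1)]
    rfl
  · rw [G.breveP_eq]
    exact ENNReal.toReal_mono (measure_ne_top _ _) hle
  · rw [G.breveP_eq, ← ENNReal.toReal_ofReal (stayBound_pos κ δ).le, measureReal_def,
      ← ENNReal.toReal_mul]
    exact ENNReal.toReal_mono hLtop hge

end Approximation

end APLA

theorem mainTheorem8 {ι : Type*} [Fintype ι] [DecidableEq ι] {A : ι → Type*}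
    [∀ i, Fintype (A i)] [∀ i, DecidableEq (A i)] [∀ i, MeasurableSpace (A i)]
    [∀ i, MeasurableSingletonClass (A i)]
    (G : APLA.Model A)
    (hu : ∀ i a, 0 < G.u i a)
    (hε : 0 < G.ε) (hν : 0 < G.ν) (hεν : G.ε * G.ν < 1)
    (hh : 0 < G.h) (hεh : G.ε * G.h < 1) (hc : 0 < G.c)
    -- the norm used for neighbourhoods, the noise level and the noise laws, as functions of `δ`
    (p : ℝ≥0∞) [Fact (1 ≤ p)]
    (υbar : ℝ → ℝ)
    (N : ℝ → Kernel (APLA.State A × APLA.Profile A) (ι → ℝ)) [∀ δ, IsMarkovKernel (N δ)]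
    -- the noise box `[-υbar, υbar]^n` lies in the open `δ`-ball (for `p = ∞`: `υbar δ < δ`)
    (hυ : ∀ᶠ δ in 𝓝[>] (0 : ℝ), ‖WithLp.toLp p (fun _ : ι => υbar δ)‖ < δ)
    (hN : ∀ᶠ δ in 𝓝[>] (0 : ℝ), ∀ z a, ∀ᵐ υ ∂(N δ (z, a)), ∀ i,
      υ i ∈ Set.Icc (-υbar δ) (υbar δ) ∧
      0 < G.ε * G.measuredUtility a υ i ∧ G.ε * G.measuredUtility a υ i < 1)
    -- a one-step transition: two pure strategy states that differ in the action of agent `j` only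
    (s s' : APLA.State A) (hs : G.IsPureStrategyState s) (hs' : G.IsPureStrategyState s')
    (j : ι) (hj : s'.action j ≠ s.action j) (hother : ∀ i, i ≠ j → s'.action i = s.action i)
    (γ : ℝ) (hγ : γ = 1 / ((Fintype.card ι : ℝ) * (Fintype.card (A j) : ℝ))) :
    -- `γ` is the probability under `Q` that `j` trembles and selects its action in `s'`
    (∀ δ, (G.oneTremble (N δ) s).real {z | z.action = s'.action} = γ) ∧
    -- the limit defining `P̂` exists
    (∀ᶠ δ in 𝓝[>] (0 : ℝ), Tendsto (fun t : ℕ => G.trembleThen (N δ) t s (APLA.nbhd p δ s'))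
      atTop (𝓝 (G.hatP (N δ) p δ s s'))) ∧
    -- `P̂ = γ P̆` asymptotically as `δ ↓ 0`
    Asymptotics.IsEquivalent (𝓝[>] (0 : ℝ)) (fun δ => G.hatP (N δ) p δ s s')
      (fun δ => γ * G.breveP (N δ) p δ s s') := by

  -- Half of the smallest utility: the other half absorbs the noise as soon as `δ < m`.
  obtain ⟨m, hm0, hm⟩ : ∃ m : ℝ, 0 < m ∧ ∀ i a, 2 * m ≤ G.u i a := by
    have : Nonempty (ι × APLA.Profile A) := ⟨(j, s.action)⟩
    obtain ⟨⟨i₀, a₀⟩, h₀⟩ := Finite.exists_min (fun q : ι × APLA.Profile A => G.u q.1 q.2)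
    exact ⟨G.u i₀ a₀ / 2, half_pos (hu _ _), fun i a => by linarith [h₀ (i, a)]⟩
  have hγ0 : 0 ≤ γ := by rw [hγ]; positivity
  set κ := min (G.ε * G.h) (G.ε * m) with hκ
  have hκ0 : 0 < κ := lt_min (mul_pos hε hh) (mul_pos hε hm0)
  have hpos : ∀ᶠ δ in 𝓝[>] (0 : ℝ), 0 < δ := self_mem_nhdsWithin
  have hsmall : ∀ r : ℝ, 0 < r → ∀ᶠ δ in 𝓝[>] (0 : ℝ), δ < r := fun r hr =>
    eventually_nhdsWithin_of_eventually_nhds (eventually_lt_nhds hr)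
  have key : ∀ᶠ δ in 𝓝[>] (0 : ℝ),
      Tendsto (fun t : ℕ => G.trembleThen (N δ) t s (APLA.nbhd p δ s')) atTop
        (𝓝 (G.hatP (N δ) p δ s s')) ∧
      G.hatP (N δ) p δ s s' ≤ γ * G.breveP (N δ) p δ s s' ∧
      APLA.stayBound κ δ * (γ * G.breveP (N δ) p δ s s') ≤ G.hatP (N δ) p δ s s' := by
    filter_upwards [hpos, hsmall m hm0, hυ, hN] with δ hδ hδm hυδ hNδ
    obtain ⟨L, hL, hle, hge⟩ := G.exists_tendsto_trembleThen hε hν hεν hh hεh hc p (N δ) hδ hυδ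
      hm hm0 hδm.le hNδ hs hs' hj hother hγ
    -- `limUnder` has an arbitrary value unless the limit exists, so convergence is established
    -- first.
    have hhat : G.hatP (N δ) p δ s s' = γ * L := hL.limUnder_eq
    rw [hhat]
    refine ⟨hL, mul_le_mul_of_nonneg_left hle hγ0, ?_⟩
    rw [mul_left_comm]
    exact mul_le_mul_of_nonneg_left hge hγ0
  refine ⟨fun δ => G.oneTremble_action (N δ) hs hj hother hγ, key.mono fun δ h => h.1, ?_⟩
  refine Asymptotics.isLittleO_iff.2 fun c hc0 => ?_
  -- With `δ < c κ²` the inequality `exp (-x) ≥ 1 - x` makes the staying bound at least `1 - c`. The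
  -- relative error is then at most `c`, and positivity of `P̆` is not required.
  filter_upwards [key, hpos, hsmall (c * κ ^ 2) (by positivity)] with δ ⟨_, h1, h2⟩ hδ hδc
  have hb : 0 ≤ γ * G.breveP (N δ) p δ s s' := mul_nonneg hγ0 measureReal_nonneg
  have hstay : 1 - c ≤ APLA.stayBound κ δ := by
    have e1 : δ / κ ^ 2 ≤ c := (div_le_iff₀ (by positivity)).2 hδc.le
    have e2 := Real.add_one_le_exp (-(δ / κ ^ 2))
    unfold APLA.stayBound
    linarith
  rw [Pi.sub_apply, Real.norm_of_nonneg hb, Real.norm_eq_abs, abs_sub_comm,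
    abs_of_nonneg (sub_nonneg.2 h1)]
  linarith [mul_le_mul_of_nonneg_right hstay hb]
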